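/- **Setting.** A two-arm bandit instance with covariates in $[0,1]$ is a law of $(X,Y^{(1)},Y^{(-1)})\in[0,1]^3$ with $\mathbb E[Y^{(k)}\mid X]=f^{(k)}(X)$, $k\in\{1,-1\}$; the rounds $(X_t,Y_t^{(1)},Y_t^{(-1)})$, $t=1,\dots,T$, are i.i.d. copies. For constants $L>0$, $\delta_0\in(0,1)$, $D_0>0$, $0<\underline c\le 1\le\bar c$, the class $\mathcal F(1,1)$ consists of the instances such that $X$ has a Lebesgue density with values in $[\underline c,\bar c]$, $|f^{(k)}(x)-f^{(k)}(x')|\le L|x-x'|$ for all $k,x,x'$, and $\mathbb P(0<|f^{(1)}(X)-f^{(-1)}(X)|\le\delta)\le D_0\delta$ for all $\delta\in[0,\delta_0]$. The regret of a policy that pulls $A_t$ in round $t$ is $R_T=\mathbb E\sum_{t=1}^T\bigl(\max_k f^{(k)}(X_t)-f^{(A_t)}(X_t)\bigr)$. **Algorithm.** Batched successive elimination with static binning, with $M=3$ batches, is given by a grid $0=t_0<t_1<t_2<t_3=T$ and a number $g\ge1$ of bins. Split $[0,1]$ into $g$ bins of width $1/g$; at the start both arms are active in each bin. In batches $i=1,2$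 (rounds $t_{i-1}<t\le t_i$) the active arms of the bin containing $X_t$ are pulled in round-robin order, restarted in each batch. At the end of batch $i$, in each bin $C$ in which both arms are active, arm $k$ is eliminated if $\max_{k'}\bar Y^{(k')}_{C,i}-\bar Y^{(k)}_{C,i}>4\sqrt{\log(2T/g)/m_{C,i}}$, where $m_{C,i}$ is the number of rounds of batch $i$ with $X_t\in C$ and $\bar Y^{(k)}_{C,i}$ is the average reward of arm $k$ in $C$ during batch $i$ (an empty average, a root of a negative number and a quotient by $0$ are read as $0$). In batch $3$ any active arm of the bin of $X_t$ is pulled. The arm with which a round robin starts and the arm pulled in batch $3$ when both are active are chosen by an arbitrary measurable rule, which may use the current round number $t$, the contexts $X_1,\dots,X_t$ and independent randomness (a fresh uniform seed in each round), but no rewards. **Theorem 4.** There is an absolute constant $\kappa>0$, and for every $L>0$ there is a constant $\tilde C_1>0$ depending only on $L$, such that the following holds for all $\delta_0\in(0,1)$, $D_0\ge\max(2/L,4)$, $0<\underline c\le1\le\bar c$. For every $T$, every grid $1\le t_1<t_2\le T-1$, every $g\ge1$ and every rule as above, there is an instance in $\mathcal F(1,1)$ on which batched successive elimination with static binning, $\hat\pi_{\mathrm{static}}$,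 satisfies $$R_T(\hat\pi_{\mathrm{static}})\ \ge\ \tilde C_1\,T^{\frac{9}{19}+\kappa}.$$ -/

import Mathlib

open MeasureTheory
open scoped unitInterval

noncomputable section

namespace BatchedBandit

/-- The two arms: `true` is arm `1`, `false` is arm `-1`; `!k` is the other arm. -/
abbrev Arm := Bool

/-! ### Nonparametric bandit instances with covariate space `[0,1]` -/

/-- A two-arm bandit instance: the common law of the vectors `(X_t, (Y_t^{(k)})_k)`, with rewards
in `[0,1]`, together with mean reward functions `f^{(k)}` with `E[Y^{(k)} | X] = f^{(k)}(X)`. -/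
structure Instance where
  law : Measure (I × (Arm → ℝ))
  isProb : IsProbabilityMeasure law
  mean : Arm → I → ℝ
  reward_mem : ∀ᵐ z ∂law, ∀ k, z.2 k ∈ Set.Icc (0 : ℝ) 1
  condMean : ∀ k,
    law[fun z => z.2 k | MeasurableSpace.comap Prod.fst inferInstance]
      =ᵐ[law] fun z => mean k z.1

attribute [instance] Instance.isProb

/-- The law `P_X` of the contexts. -/
def Instance.contextLaw (v : Instance) : Measure I := v.law.map Prod.fst

/-- The class `F(α, β)` (in dimension one) with all its constants displayed: `P_X` has a density
with values in `[c₁, c₂]`, the mean rewards are `(β, L)`-smooth, and the margin condition with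
parameter `α` holds with constants `δ₀, D₀`. -/
structure Instance.InClass (v : Instance) (α β L δ₀ D₀ c₁ c₂ : ℝ) : Prop where
  density : ∃ p : I → ℝ, Measurable p ∧ (∀ x, c₁ ≤ p x ∧ p x ≤ c₂) ∧
    v.contextLaw = volume.withDensity fun x => ENNReal.ofReal (p x)
  smooth : ∀ k, ∀ x x' : I, |v.mean k x - v.mean k x'| ≤ L * |(x : ℝ) - x'| ^ β
  margin : ∀ δ ∈ Set.Icc 0 δ₀,
    v.contextLaw.real {x | 0 < |v.mean true x - v.mean false x| ∧
      |v.mean true x - v.mean false x| ≤ δ} ≤ D₀ * δ ^ α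

/-! ### Batched successive elimination with static binning -/

/-- The outcome of one round: context, the rewards of both arms, and an independent random seed
(which the algorithm may use wherever it is free to choose an arm). -/
abbrev Round := (I × (Arm → ℝ)) × I

/-- The outcomes of all rounds; the rounds that are played are numbered `1, …, T`. -/
abbrev Outcome := ℕ → Round

/-- The context `X_t`. -/
def ctx (ω : Outcome) (t : ℕ) : I := (ω t).1.1

/-- The reward `Y_t^{(k)}`. -/
def reward (ω : Outcome) (t : ℕ) (k : Arm) : ℝ := (ω t).1.2 k

/-- The seed of round `t`. -/
def seed (ω : Outcome) (t : ℕ) : I := (ω t).2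

/-- The parameters of the algorithm: number `M` of batches, grid `0 = t_0 < t_1 < ⋯ < t_M = T`,
number `g` of bins, and a rule `tie` by which it picks an arm wherever its description leaves the
choice open. The rule sees the contexts `X_1, …, X_t` and the seed of round `t`, but no reward. -/
structure StaticBSE where
  M : ℕ
  grid : ℕ → ℕ
  g : ℕ
  tie : (t : ℕ) → (Finset.Icc 1 t → I) → I → Arm
  tie_measurable : ∀ t, Measurable fun q : (Finset.Icc 1 t → I) × I => tie t q.1 q.2

namespace StaticBSE

variable (π : StaticBSE)

/-- The horizon `T = t_M`. -/
def horizon : ℕ := π.grid π.M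

/-- The index (from `0`) of the bin of width `1/g` that contains `x`; the last bin is closed. -/
def bin (x : I) : ℕ := min ⌊(π.g : ℝ) * x⌋₊ (π.g - 1)

/-- The arm proposed by the tie-breaking rule in round `t`. -/
def tieArm (ω : Outcome) (t : ℕ) : Arm := π.tie t (fun s => ctx ω s) (seed ω t)

/-- The rounds `s` with `a < s ≤ b` whose context lies in bin `C`. -/
def visits (ω : Outcome) (a b C : ℕ) : Finset ℕ :=
  (Finset.Ioc a b).filter fun s => π.bin (ctx ω s) = C

/-- The threshold `U(τ, T, C) = 4 √(log (2 T |C|) / τ)`, where `|C| = 1/g`. -/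
def threshold (τ : ℕ) : ℝ :=
  4 * Real.sqrt (Real.log (2 * (π.horizon : ℝ) * (1 / (π.g : ℝ))) / (τ : ℝ))

/-- The first visit in the batch `(t_i, t_{i+1}]` to the bin of `X_t`. -/
def firstVisit (ω : Outcome) (i t : ℕ) : ℕ :=
  sInf {s | π.grid i < s ∧ π.bin (ctx ω s) = π.bin (ctx ω t)}

/-- Round robin among both arms in batch `(t_i, t_{i+1}]`: the first arm pulled in a bin is chosen
by the tie-breaking rule, after that the arms alternate from visit to visit. -/
def roundRobin (ω : Outcome) (i t : ℕ) : Arm :=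
  if Odd (π.visits ω (π.grid i) t (π.bin (ctx ω t))).card
  then π.tieArm ω (π.firstVisit ω i t)
  else !(π.tieArm ω (π.firstVisit ω i t))

/-- Pull arm `a` if it is active, and the remaining arm otherwise. -/
def pull (A : Finset Arm) (a : Arm) : Arm := if a ∈ A then a else !a

/-- The empirical mean of arm `k` in bin `C` in batch `(t_i, t_{i+1}]` if `A` is the set of active
arms of the bin in that batch (an arm that has not been pulled gets the value `0`). -/
def empMean (ω : Outcome) (i C : ℕ) (A : Finset Arm) (k : Arm) : ℝ :=
  (∑ s ∈ (π.visits ω (π.grid i) (π.grid (i + 1)) C).filter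
      (fun s => pull A (π.roundRobin ω i s) = k), reward ω s k) /
    ((π.visits ω (π.grid i) (π.grid (i + 1)) C).filter
      (fun s => pull A (π.roundRobin ω i s) = k)).card

/-- One elimination step in bin `C` at the end of batch `(t_i, t_{i+1}]`: if more than one arm is
active, remove each active arm whose empirical mean is below the largest one among the active
arms by more than the threshold. -/
def eliminate (ω : Outcome) (i C : ℕ) (A : Finset Arm) : Finset Arm :=
  if A.card = 1 then A
  else A.filter fun k => ¬ ∃ k' ∈ A,
    π.empMean ω i C A k' - π.empMean ω i C A k >
      π.threshold (π.visits ω (π.grid i) (π.grid (i + 1)) C).card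

/-- The set of active arms of bin `C` after `i` batches. -/
def active (ω : Outcome) : ℕ → ℕ → Finset Arm
  | 0, _ => Finset.univ
  | i + 1, C => π.eliminate ω i C (active ω i C)

/-- The number of batches that are completed before round `t`. -/
def completed (t : ℕ) : ℕ := ((Finset.Icc 1 (π.M - 1)).filter fun i => π.grid i < t).card

/-- The arm pulled in round `t`: an active arm of the bin of `X_t`, in round-robin order in the
batches `1, …, M - 1`, and any active arm in the last batch. -/
def action (ω : Outcome) (t : ℕ) : Arm :=
  pull (π.active ω (π.completed t) (π.bin (ctx ω t)))
    (if t ≤ π.grid (π.M - 1) then π.roundRobin ω (π.completed t) t else π.tieArm ω t)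

/-- The expected cumulative regret `R_T` on the instance `v`; the vectors
`(X_t, Y_t^{(1)}, Y_t^{(-1)})` are i.i.d. with law `v.law`, the seeds are i.i.d. uniform on
`[0,1]` and independent of them. -/
def regret (v : Instance) : ℝ :=
  ∫ ω : Outcome, ∑ t ∈ Finset.Icc 1 π.horizon,
    (max (v.mean true (ctx ω t)) (v.mean false (ctx ω t)) - v.mean (π.action ω t) (ctx ω t))
    ∂(Measure.infinitePi fun _ : ℕ => v.law.prod (volume : Measure I))

end StaticBSE

/-- The grid `0, t₁, t₂, T` of a three-batch policy. -/
def grid3 (t₁ t₂ T : ℕ) : ℕ → ℕ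
  | 0 => 0
  | 1 => t₁
  | 2 => t₂
  | _ => T

end BatchedBandit

end

noncomputable section

namespace BatchedBandit

/-! ### Measurability of the policy -/

/-! The exponent reached is `1/2 = 9/19 + 1/38`, and noise in the rewards is not needed. Contexts
are uniform and the arms pay the deterministic amounts `(1 ± Δ(x))/2`. Free choices of the policy
ignore rewards, so it can be run with `Δ` and with `-Δ` on the same contexts and seeds; one of the
two instances carries at least half of the joint regret (`exists_regret_ge`). Two shapes of `Δ`
suffice.

Small gaps go undetected: if `|Δ| ≤ h` and `g ≤ T`, a bin with `m` visits per batch keeps both arms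
while `m h² ≤ 11 < 16 log 2` (`active_eq_univ`). Both runs then pull the same arm and lose `|Δ|`
together. After `τ` rounds a bin has on average at most `τ/g` visits, so a tent of height `h` with
`h² ~ g/τ` costs order `h²` per round: a gap of order `h` on a set of mass of order `h`
(`exists_regret_ge_tent`).

Coarse bins cannot separate the two sides of a sign change: if `Δ` is linear with its zero in the
middle of the first bin, reflecting the current context in that bin flips the best arm but not the
active set. This costs order `1/g²` per round (`exists_regret_ge_cross`).

Heuristically the regret is thus at least of the order of each of `t₁`, `t₂ g / t₁`, `T g / t₂` and
`T / g²`. Their product is `T²`, so one of them is at least `√T`; the balance is at `t₁ ~ T^(1/2)`,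
`g ~ T^(1/4)`, `t₂ ~ T^(3/4)`, and `exists_regret_ge_sqrt` splits cases there. The case `g > T`,
where the logarithm in the threshold may fail to be positive, is settled by empty bins. -/

/-- Lets a random discrete index (a bin, a time, a set of rounds, an arm) be substituted into a
family that is measurable for each fixed index. -/
theorem measurable_apply_countable {α β γ : Type*} [MeasurableSpace α] [Countable α]
    [MeasurableSingletonClass α] [MeasurableSpace β] [MeasurableSpace γ]
    {f : α → β → γ} (hf : ∀ a, Measurable (f a)) {n : β → α} (hn : Measurable n) :
    Measurable fun b => f (n b) b := by
  have h : Measurable fun p : α × β => f p.1 p.2 := measurable_from_prod_countable_right hf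
  exact h.comp (hn.prodMk measurable_id)

@[fun_prop]
theorem measurable_ctx (t : ℕ) : Measurable fun ω : Outcome => ctx ω t := by
  unfold ctx; fun_prop

@[fun_prop]
theorem measurable_seed (t : ℕ) : Measurable fun ω : Outcome => seed ω t := by
  unfold seed; fun_prop

@[fun_prop]
theorem measurable_reward (t : ℕ) (k : Arm) : Measurable fun ω : Outcome => reward ω t k := by
  unfold reward; fun_prop

theorem measurable_nat_sInf {α : Type*} [MeasurableSpace α] {p : ℕ → α → Prop}
    (hp : ∀ s, MeasurableSet {x | p s x}) : Measurable fun x => sInf {s | p s x} := by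
  classical
  refine measurable_to_countable' fun n => ?_
  have : (fun x => sInf {s | p s x}) ⁻¹' {n} =
      ({x | p n x} ∩ ⋂ m, ⋂ (_ : m < n), {x | p m x}ᶜ) ∪
        -- The second piece accounts for the convention `sInf ∅ = 0`.
        ({_x | n = 0} ∩ ⋂ m, {x | p m x}ᶜ) := by
    ext x
    simp only [Set.mem_preimage, Set.mem_singleton_iff, Set.mem_union, Set.mem_inter_iff,
      Set.mem_iInter, Set.mem_compl_iff, Set.mem_ofPred_eq]
    constructor
    · rintro rfl
      by_cases h : {s | p s x}.Nonempty
      · exact Or.inl ⟨Nat.sInf_mem h, fun m hm => Nat.notMem_of_lt_sInf hm⟩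
      · rw [Set.not_nonempty_iff_eq_empty] at h
        refine Or.inr ⟨by simp [h], fun m hm => ?_⟩
        have : m ∈ {s | p s x} := hm
        simp [h] at this
    · rintro (⟨h1, h2⟩ | ⟨rfl, h⟩)
      · refine le_antisymm (Nat.sInf_le h1) ?_
        by_contra hlt
        exact h2 _ (not_le.1 hlt) (Nat.sInf_mem (s := {s | p s x}) ⟨n, h1⟩)
      · have : {s | p s x} = ∅ := Set.eq_empty_of_forall_notMem h
        simp [this]
  rw [this]
  refine MeasurableSet.union ((hp n).inter ?_) (MeasurableSet.inter (.const _) ?_)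
  · exact .iInter fun m => .iInter fun _ => (hp m).compl
  · exact .iInter fun m => (hp m).compl

namespace StaticBSE

variable (π : StaticBSE)

@[fun_prop]
theorem measurable_bin : Measurable π.bin := by
  unfold bin
  exact (Nat.measurable_floor.comp (by fun_prop)).min measurable_const

theorem measurable_binCtx (t : ℕ) : Measurable fun ω : Outcome => π.bin (ctx ω t) :=
  π.measurable_bin.comp (measurable_ctx t)

theorem measurable_visits (a b C : ℕ) : Measurable fun ω : Outcome => π.visits ω a b C := by
  rw [measurable_finset_iff]
  intro s
  simp only [visits, Finset.mem_filter]
  refine Measurable.and measurable_const ?_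
  exact measurableSet_setOfPred.1 (π.measurable_binCtx s (measurableSet_singleton C))

theorem measurable_tieArm (t : ℕ) : Measurable fun ω : Outcome => π.tieArm ω t := by
  unfold tieArm
  exact (π.tie_measurable t).comp
    (f := fun ω : Outcome => ((fun s : Finset.Icc 1 t => ctx ω s), seed ω t))
    ((measurable_pi_lambda (fun (ω : Outcome) (s : Finset.Icc 1 t) => ctx ω s)
      fun s => measurable_ctx s).prodMk (measurable_seed t))

theorem measurable_firstVisit (i t : ℕ) : Measurable fun ω : Outcome => π.firstVisit ω i t := by
  unfold firstVisit
  refine measurable_nat_sInf fun s => ?_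
  exact MeasurableSet.inter (.const _)
    (measurableSet_eq_fun (π.measurable_binCtx s) (π.measurable_binCtx t))

theorem measurable_roundRobin (i t : ℕ) : Measurable fun ω : Outcome => π.roundRobin ω i t := by
  have h1 : Measurable fun ω : Outcome => π.tieArm ω (π.firstVisit ω i t) :=
    measurable_apply_countable (f := fun n ω => π.tieArm ω n) π.measurable_tieArm
      (π.measurable_firstVisit i t)
  have h2 : Measurable fun ω : Outcome => π.visits ω (π.grid i) t (π.bin (ctx ω t)) :=
    measurable_apply_countable (f := fun C ω => π.visits ω (π.grid i) t C)
      (fun C => π.measurable_visits _ _ C) (π.measurable_binCtx t)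
  unfold roundRobin
  refine Measurable.ite ?_ h1 ((Measurable.of_discrete (f := not)).comp h1)
  exact h2 (Set.Countable.measurableSet (Set.to_countable {S : Finset ℕ | Odd S.card}))

theorem measurable_pulls (i C : ℕ) (A : Finset Arm) (k : Arm) :
    Measurable fun ω : Outcome => (π.visits ω (π.grid i) (π.grid (i + 1)) C).filter
      (fun s => pull A (π.roundRobin ω i s) = k) := by
  rw [measurable_finset_iff]
  intro s
  simp only [Finset.mem_filter]
  refine Measurable.and (measurable_finset_iff.1 (π.measurable_visits _ _ C) s) ?_
  have h : Measurable fun ω : Outcome => pull A (π.roundRobin ω i s) :=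
    (Measurable.of_discrete (f := pull A)).comp (π.measurable_roundRobin i s)
  exact measurableSet_setOfPred.1 (h (measurableSet_singleton k))

theorem measurable_empMean (i C : ℕ) (A : Finset Arm) (k : Arm) :
    Measurable fun ω : Outcome => π.empMean ω i C A k :=
  measurable_apply_countable
    (f := fun (S : Finset ℕ) (ω : Outcome) => (∑ s ∈ S, reward ω s k) / (S.card : ℝ))
    (fun S => (Finset.measurable_sum S fun s _ => measurable_reward s k).div_const _)
    (π.measurable_pulls i C A k)

theorem measurable_eliminate (i C : ℕ) (A : Finset Arm) :
    Measurable fun ω : Outcome => π.eliminate ω i C A := by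
  unfold eliminate
  split_ifs
  · exact measurable_const
  · rw [measurable_finset_iff]
    intro k
    simp only [Finset.mem_filter]
    refine Measurable.and measurable_const (Measurable.not (Measurable.exists fun k' =>
      Measurable.and measurable_const ?_))
    refine measurableSet_setOfPred.1 (measurableSet_lt ?_
      ((π.measurable_empMean i C A k').sub (π.measurable_empMean i C A k)))
    exact (Measurable.of_discrete
      (f := fun S : Finset ℕ => π.threshold S.card)).comp (π.measurable_visits _ _ C)

theorem measurable_active (i C : ℕ) : Measurable fun ω : Outcome => π.active ω i C := by
  induction i with
  | zero => exact measurable_const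
  | succ i ih =>
    exact measurable_apply_countable (f := fun A ω => π.eliminate ω i C A)
      (π.measurable_eliminate i C) ih

theorem measurable_action (t : ℕ) : Measurable fun ω : Outcome => π.action ω t := by
  have h1 : Measurable fun ω : Outcome => π.active ω (π.completed t) (π.bin (ctx ω t)) :=
    measurable_apply_countable (f := fun C ω => π.active ω (π.completed t) C)
      (fun C => π.measurable_active _ C) (π.measurable_binCtx t)
  have h2 : Measurable fun ω : Outcome =>
      if t ≤ π.grid (π.M - 1) then π.roundRobin ω (π.completed t) t else π.tieArm ω t := by
    split_ifs
    exacts [π.measurable_roundRobin _ _, π.measurable_tieArm _]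
  exact (Measurable.of_discrete (f := fun p : Finset Arm × Arm => pull p.1 p.2)).comp
    (h1.prodMk h2)

end StaticBSE

/-! ### Instances with deterministic rewards and a prescribed gap -/

/-- The sign attached to an arm. -/
def armSign (k : Arm) : ℝ := if k then 1 else -1

/-- The reward function of arm `k` for the gap function `Δ`. -/
def gapMean (Δ : I → ℝ) (k : Arm) (x : I) : ℝ := (1 + armSign k * Δ x) / 2

theorem abs_armSign (k : Arm) : |armSign k| = 1 := by cases k <;> simp [armSign]

theorem measurable_gapMean {Δ : I → ℝ} (hm : Measurable Δ) (k : Arm) :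
    Measurable (gapMean Δ k) := by
  unfold gapMean; fun_prop

theorem gapMean_mem {Δ : I → ℝ} (hb : ∀ x, |Δ x| ≤ 1) (k : Arm) (x : I) :
    gapMean Δ k x ∈ Set.Icc (0 : ℝ) 1 := by
  have := abs_le.1 (hb x)
  cases k <;> simp only [gapMean, armSign, Set.mem_Icc] <;> constructor <;> norm_num <;> linarith

theorem measurable_graph {Δ : I → ℝ} (hm : Measurable Δ) :
    Measurable fun x : I => (x, fun k => gapMean Δ k x) :=
  measurable_id.prodMk (measurable_pi_lambda _ fun k => measurable_gapMean hm k)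

/-- The instance with uniform contexts and deterministic rewards `gapMean Δ`. -/
def gapInstance (Δ : I → ℝ) (hm : Measurable Δ) (hb : ∀ x, |Δ x| ≤ 1) : Instance where
  law := (volume : Measure I).map fun x => (x, fun k => gapMean Δ k x)
  isProb := Measure.isProbabilityMeasure_map (measurable_graph hm).aemeasurable
  mean := gapMean Δ
  reward_mem := by
    rw [ae_map_iff (measurable_graph hm).aemeasurable]
    · exact Filter.Eventually.of_forall fun x k => gapMean_mem hb k x
    · simp only [Set.ofPred_forall]
      exact MeasurableSet.iInter fun k =>
        ((measurable_pi_apply k).comp measurable_snd) measurableSet_Icc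
  condMean := by
    intro k
    set μ := (volume : Measure I).map fun x => (x, fun k => gapMean Δ k x)
    have : IsProbabilityMeasure μ :=
      Measure.isProbabilityMeasure_map (measurable_graph hm).aemeasurable
    have hae : (fun z : I × (Arm → ℝ) => z.2 k) =ᵐ[μ] fun z => gapMean Δ k z.1 := by
      refine (ae_map_iff (measurable_graph hm).aemeasurable ?_).2
        (Filter.Eventually.of_forall fun x => rfl)
      exact measurableSet_eq_fun ((measurable_pi_apply k).comp measurable_snd)
        ((measurable_gapMean hm k).comp measurable_fst)
    refine (condExp_congr_ae hae).trans ?_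
    refine Filter.EventuallyEq.of_eq
      (condExp_of_stronglyMeasurable measurable_fst.comap_le ?_ ?_)
    · exact ((measurable_gapMean hm k).comp (comap_measurable Prod.fst)).stronglyMeasurable
    · refine Integrable.of_bound
        ((measurable_gapMean hm k).comp measurable_fst).aestronglyMeasurable 1
        (Filter.Eventually.of_forall fun z => ?_)
      have := gapMean_mem hb k z.1
      rw [Real.norm_eq_abs, abs_le]
      exact ⟨by linarith [this.1], this.2⟩

theorem gapInstance_contextLaw (Δ : I → ℝ) (hm : Measurable Δ) (hb : ∀ x, |Δ x| ≤ 1) :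
    (gapInstance Δ hm hb).contextLaw = volume := by
  change Measure.map Prod.fst ((volume : Measure I).map _) = _
  rw [Measure.map_map measurable_fst (measurable_graph hm)]
  exact Measure.map_id

theorem gapMean_sub (Δ : I → ℝ) (x : I) : gapMean Δ true x - gapMean Δ false x = Δ x := by
  simp only [gapMean, armSign]; norm_num; ring

/-- Each arm carries half of the gap, so `Δ` may have slope up to `2 * L`. -/
theorem gapInstance_inClass {Δ : I → ℝ} (hm : Measurable Δ) (hb : ∀ x, |Δ x| ≤ 1)
    {L δ₀ D₀ c₁ c₂ : ℝ} (hc₁ : c₁ ≤ 1) (hc₂ : 1 ≤ c₂)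
    (hL : ∀ x x' : I, |Δ x - Δ x'| ≤ 2 * L * |(x : ℝ) - x'|)
    (hD : ∀ δ ∈ Set.Icc 0 δ₀, (volume : Measure I).real {x | 0 < |Δ x| ∧ |Δ x| ≤ δ} ≤ D₀ * δ) :
    (gapInstance Δ hm hb).InClass 1 1 L δ₀ D₀ c₁ c₂ where
  density := ⟨fun _ => 1, measurable_const, fun _ => ⟨hc₁, hc₂⟩, by
    rw [gapInstance_contextLaw]; simp⟩
  smooth k x x' := by
    have h : (gapInstance Δ hm hb).mean k x - (gapInstance Δ hm hb).mean k x' =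
        armSign k * (Δ x - Δ x') / 2 := by
      simp only [gapInstance, gapMean]; ring
    rw [h, abs_div, abs_mul, abs_armSign, Real.rpow_one, one_mul, abs_two]
    linarith [hL x x']
  margin δ hδ := by
    rw [gapInstance_contextLaw, Real.rpow_one]
    change (volume : Measure I).real {x | 0 < |gapMean Δ true x - gapMean Δ false x| ∧
      |gapMean Δ true x - gapMean Δ false x| ≤ δ} ≤ _
    simp only [gapMean_sub]
    exact hD δ hδ

/-- The law of the contexts and seeds of all rounds. -/
def baseLaw : Measure (ℕ → I × I) :=
  Measure.infinitePi fun _ : ℕ => (volume : Measure I).prod (volume : Measure I)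

instance : IsProbabilityMeasure baseLaw := by unfold baseLaw; infer_instance

/-- The outcome with contexts and seeds `η` and rewards `gapMean Δ`. -/
def outcome (Δ : I → ℝ) (η : ℕ → I × I) : Outcome :=
  fun t => (((η t).1, fun k => gapMean Δ k (η t).1), (η t).2)

theorem measurable_round {Δ : I → ℝ} (hm : Measurable Δ) :
    Measurable fun p : I × I => (((p.1, fun k => gapMean Δ k p.1), p.2) : Round) :=
  ((measurable_graph hm).comp measurable_fst).prodMk measurable_snd

theorem measurable_outcome {Δ : I → ℝ} (hm : Measurable Δ) : Measurable (outcome Δ) :=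
  measurable_pi_lambda _ fun t => (measurable_round hm).comp (measurable_pi_apply t)

/-- This is the coupling: all gap instances live on the single space `baseLaw` of contexts and
seeds. -/
theorem map_outcome {Δ : I → ℝ} (hm : Measurable Δ) (hb : ∀ x, |Δ x| ≤ 1) :
    baseLaw.map (outcome Δ) = Measure.infinitePi
      fun _ : ℕ => (gapInstance Δ hm hb).law.prod (volume : Measure I) := by
  have h := Measure.infinitePi_map_pi
    (fun _ : ℕ => (volume : Measure I).prod (volume : Measure I))
    (f := fun _ p => (((p.1, fun k => gapMean Δ k p.1), p.2) : Round))
    (fun _ => measurable_round hm)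
  refine h.trans ?_
  congr 1
  funext _
  have h2 := Measure.map_prod_map (volume : Measure I) (volume : Measure I)
    (measurable_graph hm) measurable_id
  rw [Measure.map_id] at h2
  exact h2.symm

/-! ### Joint regret of the gaps `Δ` and `-Δ` -/

namespace StaticBSE

variable (π : StaticBSE)

/-- The regret of round `t` on the instance with gap `Δ`. -/
def gapLoss (Δ : I → ℝ) (t : ℕ) (η : ℕ → I × I) : ℝ :=
  (|Δ (η t).1| - armSign (π.action (outcome Δ η) t) * Δ (η t).1) / 2

theorem gapLoss_eq (Δ : I → ℝ) (t : ℕ) (η : ℕ → I × I) :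
    max (gapMean Δ true (η t).1) (gapMean Δ false (η t).1) -
      gapMean Δ (π.action (outcome Δ η) t) (η t).1 = π.gapLoss Δ t η := by
  have h : max (gapMean Δ true (η t).1) (gapMean Δ false (η t).1) = (1 + |Δ (η t).1|) / 2 := by
    simp only [gapMean, armSign]
    rcases le_total 0 (Δ (η t).1) with h | h
    · rw [abs_of_nonneg h, max_eq_left] <;> norm_num; linarith
    · rw [abs_of_nonpos h, max_eq_right] <;> norm_num; linarith
  rw [h, gapMean, gapLoss]
  ring

theorem gapLoss_nonneg (Δ : I → ℝ) (t : ℕ) (η : ℕ → I × I) : 0 ≤ π.gapLoss Δ t η := by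
  have := le_abs_self (armSign (π.action (outcome Δ η) t) * Δ (η t).1)
  rw [abs_mul, abs_armSign, one_mul] at this
  unfold gapLoss; linarith

theorem gapLoss_le {Δ : I → ℝ} (hb : ∀ x, |Δ x| ≤ 1) (t : ℕ) (η : ℕ → I × I) :
    π.gapLoss Δ t η ≤ 1 := by
  have := neg_abs_le (armSign (π.action (outcome Δ η) t) * Δ (η t).1)
  rw [abs_mul, abs_armSign, one_mul] at this
  unfold gapLoss; linarith [hb (η t).1]

theorem measurable_gapLoss {Δ : I → ℝ} (hm : Measurable Δ) (t : ℕ) :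
    Measurable (π.gapLoss Δ t) := by
  have h1 : Measurable fun η : ℕ → I × I => Δ (η t).1 :=
    hm.comp (measurable_fst.comp (measurable_pi_apply t))
  have h2 : Measurable fun η : ℕ → I × I => armSign (π.action (outcome Δ η) t) :=
    (Measurable.of_discrete (f := armSign)).comp
      ((π.measurable_action t).comp (measurable_outcome hm))
  have h3 : Measurable fun η : ℕ → I × I => |Δ (η t).1| := measurable_norm.comp h1
  exact (h3.sub (h2.mul h1)).div_const 2

theorem integrable_gapLoss {Δ : I → ℝ} (hm : Measurable Δ) (hb : ∀ x, |Δ x| ≤ 1) (t : ℕ) :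
    Integrable (π.gapLoss Δ t) baseLaw := by
  refine Integrable.of_bound (π.measurable_gapLoss hm t).aestronglyMeasurable 1
    (Filter.Eventually.of_forall fun η => ?_)
  rw [Real.norm_eq_abs, abs_of_nonneg (π.gapLoss_nonneg Δ t η)]
  exact π.gapLoss_le hb t η

theorem regret_gapInstance {Δ : I → ℝ} (hm : Measurable Δ) (hb : ∀ x, |Δ x| ≤ 1) :
    π.regret (gapInstance Δ hm hb) =
      ∑ t ∈ Finset.Icc 1 π.horizon, ∫ η, π.gapLoss Δ t η ∂baseLaw := by
  have hmean (t : ℕ) : Measurable fun ω : Outcome => gapMean Δ (π.action ω t) (ctx ω t) :=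
    measurable_apply_countable (f := fun k ω => gapMean Δ k (ctx ω t))
      (fun k => (measurable_gapMean hm k).comp (measurable_ctx t)) (π.measurable_action t)
  have hmeas : Measurable fun ω : Outcome => ∑ t ∈ Finset.Icc 1 π.horizon,
      (max (gapMean Δ true (ctx ω t)) (gapMean Δ false (ctx ω t)) -
        gapMean Δ (π.action ω t) (ctx ω t)) :=
    Finset.measurable_sum _ fun t _ =>
      (((measurable_gapMean hm true).comp (measurable_ctx t)).max
        ((measurable_gapMean hm false).comp (measurable_ctx t))).sub (hmean t)
  unfold regret
  rw [← map_outcome hm hb]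
  change ∫ ω : Outcome, ∑ t ∈ Finset.Icc 1 π.horizon,
      (max (gapMean Δ true (ctx ω t)) (gapMean Δ false (ctx ω t)) -
        gapMean Δ (π.action ω t) (ctx ω t)) ∂(baseLaw.map (outcome Δ)) = _
  rw [integral_map (measurable_outcome hm).aemeasurable hmeas.aestronglyMeasurable,
    ← integral_finsetSum _ fun t _ => π.integrable_gapLoss hm hb t]
  refine integral_congr_ae (Filter.Eventually.of_forall fun η => ?_)
  exact Finset.sum_congr rfl fun t _ => π.gapLoss_eq Δ t η

/-- One of the two instances with gaps `Δ` and `-Δ` has at least half of the total regret. -/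
theorem exists_regret_ge {Δ : I → ℝ} (hm : Measurable Δ) (hb : ∀ x, |Δ x| ≤ 1)
    {L δ₀ D₀ c₁ c₂ : ℝ} (hc₁ : c₁ ≤ 1) (hc₂ : 1 ≤ c₂)
    (hL : ∀ x x' : I, |Δ x - Δ x'| ≤ 2 * L * |(x : ℝ) - x'|)
    (hD : ∀ δ ∈ Set.Icc 0 δ₀, (volume : Measure I).real {x | 0 < |Δ x| ∧ |Δ x| ≤ δ} ≤ D₀ * δ)
    {S : Finset ℕ} (hS : S ⊆ Finset.Icc 1 π.horizon) {r : ℝ}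
    (hr : ∀ t ∈ S, r ≤ ∫ η, (π.gapLoss Δ t η + π.gapLoss (fun x => -Δ x) t η) ∂baseLaw) :
    ∃ v : Instance, v.InClass 1 1 L δ₀ D₀ c₁ c₂ ∧ S.card * r / 2 ≤ π.regret v := by
  have hm' : Measurable fun x => -Δ x := hm.neg
  have hb' : ∀ x, |-Δ x| ≤ 1 := fun x => by rw [abs_neg]; exact hb x
  have hsum : S.card * r ≤ π.regret (gapInstance Δ hm hb) +
      π.regret (gapInstance (fun x => -Δ x) hm' hb') := by
    rw [regret_gapInstance, regret_gapInstance, ← Finset.sum_add_distrib]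
    calc S.card * r = ∑ t ∈ S, r := by simp
      _ ≤ ∑ t ∈ S, (∫ η, π.gapLoss Δ t η ∂baseLaw +
          ∫ η, π.gapLoss (fun x => -Δ x) t η ∂baseLaw) := by
        refine Finset.sum_le_sum fun t ht => ?_
        rw [← integral_add (π.integrable_gapLoss hm hb t) (π.integrable_gapLoss hm' hb' t)]
        exact hr t ht
      _ ≤ _ := Finset.sum_le_sum_of_subset_of_nonneg hS fun t _ _ =>
        add_nonneg (integral_nonneg fun η => π.gapLoss_nonneg _ t η)
          (integral_nonneg fun η => π.gapLoss_nonneg _ t η)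
  by_cases h : S.card * r / 2 ≤ π.regret (gapInstance Δ hm hb)
  · exact ⟨_, gapInstance_inClass hm hb hc₁ hc₂ hL hD, h⟩
  · refine ⟨_, gapInstance_inClass hm' hb' hc₁ hc₂ (fun x x' => ?_) (fun δ hδ => ?_), ?_⟩
    · rw [neg_sub_neg, abs_sub_comm]; exact hL x x'
    · simpa only [abs_neg] using hD δ hδ
    · linarith

end StaticBSE

/-! ### The elimination rule on instances with deterministic rewards -/

namespace StaticBSE

variable (π : StaticBSE)

/-- The first two visits of a batch share the same `firstVisit` and have visit counts one and two,
so they receive opposite arms. With two visits, therefore, no average takes the default value `0`.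
-/
theorem roundRobin_pulls_both (ω : Outcome) (i b C : ℕ)
    (h : 2 ≤ (π.visits ω (π.grid i) b C).card) (k : Arm) :
    ((π.visits ω (π.grid i) b C).filter fun s => π.roundRobin ω i s = k).Nonempty := by
  set V := π.visits ω (π.grid i) b C with hV
  have mem_V (s : ℕ) : s ∈ V ↔ (π.grid i < s ∧ s ≤ b) ∧ π.bin (ctx ω s) = C := by
    simp [hV, visits]
  have hne : V.Nonempty := Finset.card_pos.1 (by omega)
  set s₁ := V.min' hne with hs₁
  have h₁ : s₁ ∈ V := V.min'_mem hne
  have hne' : (V.erase s₁).Nonempty := Finset.card_pos.1 (by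
    rw [Finset.card_erase_of_mem h₁]; omega)
  set s₂ := (V.erase s₁).min' hne' with hs₂
  have h₂ : s₂ ∈ V.erase s₁ := Finset.min'_mem _ hne'
  rw [Finset.mem_erase] at h₂
  have hlt : s₁ < s₂ := lt_of_le_of_ne (V.min'_le _ h₂.2) (Ne.symm h₂.1)
  have hbin₁ := ((mem_V s₁).1 h₁).2
  have hbin₂ := ((mem_V s₂).1 h₂.2).2
  have hv₁ : π.visits ω (π.grid i) s₁ (π.bin (ctx ω s₁)) = {s₁} := by
    ext s
    rw [hbin₁, visits, Finset.mem_filter, Finset.mem_Ioc, Finset.mem_singleton]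
    constructor
    · rintro ⟨⟨ha, hb⟩, hc⟩
      exact le_antisymm hb
        (V.min'_le s ((mem_V s).2 ⟨⟨ha, hb.trans ((mem_V s₁).1 h₁).1.2⟩, hc⟩))
    · rintro rfl
      exact ⟨⟨((mem_V s₁).1 h₁).1.1, le_rfl⟩, hbin₁⟩
  have hv₂ : π.visits ω (π.grid i) s₂ (π.bin (ctx ω s₂)) = {s₁, s₂} := by
    ext s
    rw [hbin₂, visits, Finset.mem_filter, Finset.mem_Ioc, Finset.mem_insert,
      Finset.mem_singleton]
    constructor
    · rintro ⟨⟨ha, hb⟩, hc⟩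
      by_cases hs : s = s₁
      · exact Or.inl hs
      · exact Or.inr (le_antisymm hb ((V.erase s₁).min'_le s (Finset.mem_erase.2
          ⟨hs, (mem_V s).2 ⟨⟨ha, hb.trans ((mem_V s₂).1 h₂.2).1.2⟩, hc⟩⟩)))
    · rintro (rfl | rfl)
      · exact ⟨⟨((mem_V s₁).1 h₁).1.1, hlt.le⟩, hbin₁⟩
      · exact ⟨⟨((mem_V s₂).1 h₂.2).1.1, le_rfl⟩, hbin₂⟩
  have hf : π.firstVisit ω i s₂ = π.firstVisit ω i s₁ := by
    simp only [firstVisit, hbin₁, hbin₂]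
  have hr₁ : π.roundRobin ω i s₁ = π.tieArm ω (π.firstVisit ω i s₁) := by
    rw [roundRobin, hv₁, if_pos (by simp)]
  have hr₂ : π.roundRobin ω i s₂ = !(π.tieArm ω (π.firstVisit ω i s₁)) := by
    rw [roundRobin, hv₂, Finset.card_pair hlt.ne, if_neg (by decide), hf]
  by_cases hk : π.tieArm ω (π.firstVisit ω i s₁) = k
  · exact ⟨s₁, Finset.mem_filter.2 ⟨h₁, hr₁.trans hk⟩⟩
  · refine ⟨s₂, Finset.mem_filter.2 ⟨h₂.2, hr₂.trans ?_⟩⟩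
    revert hk; cases π.tieArm ω (π.firstVisit ω i s₁) <;> cases k <;> simp

theorem threshold_nonneg (m : ℕ) : 0 ≤ π.threshold m := by
  unfold threshold; positivity

/-- For `g ≤ T` the logarithm is at least `log 2`, and `16 log 2 > 11`. -/
theorem le_threshold (hg : 1 ≤ π.g) (hgT : π.g ≤ π.horizon) {m : ℕ} (hm : 1 ≤ m) {x : ℝ}
    (hx : m * x ^ 2 ≤ 11) : x ≤ π.threshold m := by
  have hm' : (0 : ℝ) < m := by exact_mod_cast hm
  have hg' : (0 : ℝ) < π.g := by exact_mod_cast hg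
  have hgT' : (π.g : ℝ) ≤ π.horizon := by exact_mod_cast hgT
  have hlog : Real.log 2 ≤ Real.log (2 * (π.horizon : ℝ) * (1 / (π.g : ℝ))) := by
    refine Real.log_le_log (by norm_num) ?_
    rw [mul_one_div, le_div_iff₀ hg']
    linarith
  have h2 := Real.log_two_gt_d9
  have key : x / 4 ≤ Real.sqrt (Real.log (2 * (π.horizon : ℝ) * (1 / (π.g : ℝ))) / (m : ℝ)) := by
    refine Real.le_sqrt_of_sq_le ?_
    rw [le_div_iff₀ hm']
    nlinarith
  unfold threshold
  linarith

theorem eliminate_of_ne_univ (ω : Outcome) (i C : ℕ) {A : Finset Arm} (hA : A ≠ Finset.univ) :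
    π.eliminate ω i C A = A := by
  have : A = ∅ ∨ A.card = 1 := by revert hA; revert A; decide
  unfold eliminate
  rcases this with rfl | h
  · simp
  · rw [if_pos h]

theorem eliminate_univ (ω : Outcome) (i C : ℕ) : π.eliminate ω i C Finset.univ =
    Finset.univ.filter fun k => ¬ ∃ k', π.empMean ω i C Finset.univ k' -
      π.empMean ω i C Finset.univ k >
        π.threshold (π.visits ω (π.grid i) (π.grid (i + 1)) C).card := by
  unfold eliminate
  rw [if_neg (by decide)]
  simp

theorem eliminate_univ_eq_univ {ω : Outcome} {i C : ℕ}
    (h : ∀ k k', π.empMean ω i C Finset.univ k' - π.empMean ω i C Finset.univ k ≤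
      π.threshold (π.visits ω (π.grid i) (π.grid (i + 1)) C).card) :
    π.eliminate ω i C Finset.univ = Finset.univ := by
  rw [eliminate_univ, Finset.filter_true_of_mem]
  rintro k - ⟨k', hk'⟩
  exact absurd hk' (not_lt.2 (h k k'))

theorem pull_univ (a : Arm) : pull Finset.univ a = a := by simp [pull]

theorem empMean_univ (ω : Outcome) (i C : ℕ) (k : Arm) : π.empMean ω i C Finset.univ k =
    (∑ s ∈ (π.visits ω (π.grid i) (π.grid (i + 1)) C).filter (fun s => π.roundRobin ω i s = k),
      reward ω s k) /
    ((π.visits ω (π.grid i) (π.grid (i + 1)) C).filter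
      (fun s => π.roundRobin ω i s = k)).card := by
  simp only [empMean, pull_univ]

theorem empMean_outcome_mem {Δ : I → ℝ} (hb : ∀ x, |Δ x| ≤ 1) (η : ℕ → I × I) (i C : ℕ)
    (k : Arm) : π.empMean (outcome Δ η) i C Finset.univ k ∈ Set.Icc (0 : ℝ) 1 := by
  rw [empMean_univ]
  set S := (π.visits (outcome Δ η) (π.grid i) (π.grid (i + 1)) C).filter
    (fun s => π.roundRobin (outcome Δ η) i s = k)
  have h (s : ℕ) : reward (outcome Δ η) s k ∈ Set.Icc (0 : ℝ) 1 := gapMean_mem hb k _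
  refine ⟨div_nonneg (Finset.sum_nonneg fun s _ => (h s).1) (Nat.cast_nonneg _), ?_⟩
  refine div_le_one_of_le₀ ?_ (Nat.cast_nonneg _)
  simpa using Finset.sum_le_card_nsmul S _ 1 fun s _ => (h s).2

theorem abs_empMean_outcome_sub_le {Δ : I → ℝ} {h : ℝ} (hb : ∀ x, |Δ x| ≤ h) (η : ℕ → I × I)
    (i C : ℕ) (k : Arm)
    (hV : 2 ≤ (π.visits (outcome Δ η) (π.grid i) (π.grid (i + 1)) C).card) :
    |π.empMean (outcome Δ η) i C Finset.univ k - 1 / 2| ≤ h / 2 := by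
  have hne := π.roundRobin_pulls_both _ _ _ _ hV k
  rw [empMean_univ]
  set S := (π.visits (outcome Δ η) (π.grid i) (π.grid (i + 1)) C).filter
    (fun s => π.roundRobin (outcome Δ η) i s = k)
  have hS : (0 : ℝ) < S.card := by exact_mod_cast Finset.card_pos.2 hne
  have hr (s : ℕ) : |reward (outcome Δ η) s k - 1 / 2| ≤ h / 2 := by
    have : reward (outcome Δ η) s k - 1 / 2 = armSign k * Δ (η s).1 / 2 := by
      change gapMean Δ k (η s).1 - 1 / 2 = _
      unfold gapMean; ring
    rw [this, abs_div, abs_mul, abs_armSign, one_mul, abs_two]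
    linarith [hb (η s).1]
  have : (∑ s ∈ S, reward (outcome Δ η) s k) / (S.card : ℝ) - 1 / 2 =
      (∑ s ∈ S, (reward (outcome Δ η) s k - 1 / 2)) / S.card := by
    rw [Finset.sum_sub_distrib, Finset.sum_const, nsmul_eq_mul]
    field_simp
  rw [this, abs_div, abs_of_pos hS, div_le_iff₀ hS]
  refine (Finset.abs_sum_le_sum_abs _ _).trans ((Finset.sum_le_card_nsmul S _ (h / 2)
    fun s _ => hr s).trans ?_)
  rw [nsmul_eq_mul, mul_comm]

/-- The same rounds are averaged, and every reward `r` becomes `1 - r`. Two visits are required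
because an empty average is `0` for both gaps. -/
theorem empMean_outcome_neg (Δ : I → ℝ) (η : ℕ → I × I) (i C : ℕ) (k : Arm)
    (hV : 2 ≤ (π.visits (outcome Δ η) (π.grid i) (π.grid (i + 1)) C).card) :
    π.empMean (outcome (fun x => -Δ x) η) i C Finset.univ k =
      1 - π.empMean (outcome Δ η) i C Finset.univ k := by
  have hne := π.roundRobin_pulls_both _ _ _ _ hV k
  rw [empMean_univ, empMean_univ]
  change (∑ s ∈ (π.visits (outcome Δ η) (π.grid i) (π.grid (i + 1)) C).filter
    (fun s => π.roundRobin (outcome Δ η) i s = k), reward (outcome (fun x => -Δ x) η) s k) /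
    (((π.visits (outcome Δ η) (π.grid i) (π.grid (i + 1)) C).filter
    (fun s => π.roundRobin (outcome Δ η) i s = k)).card : ℝ) = _
  set S := (π.visits (outcome Δ η) (π.grid i) (π.grid (i + 1)) C).filter
    (fun s => π.roundRobin (outcome Δ η) i s = k)
  have hS : (S.card : ℝ) ≠ 0 := by exact_mod_cast (Finset.card_pos.2 hne).ne'
  have hr (s : ℕ) : reward (outcome (fun x => -Δ x) η) s k = 1 - reward (outcome Δ η) s k := by
    change gapMean (fun x => -Δ x) k (η s).1 = 1 - gapMean Δ k (η s).1
    unfold gapMean; ring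
  simp only [hr]
  rw [Finset.sum_sub_distrib, Finset.sum_const, nsmul_eq_mul]
  field_simp

/-- With at most one visit in a batch, no arm is eliminated. -/
theorem eliminate_univ_of_card_le_one {Δ : I → ℝ} (hb : ∀ x, |Δ x| ≤ 1) (η : ℕ → I × I)
    {i C : ℕ} (hg : 1 ≤ π.g)
    (h : (π.visits (outcome Δ η) (π.grid i) (π.grid (i + 1)) C).card = 0 ∨
      (π.visits (outcome Δ η) (π.grid i) (π.grid (i + 1)) C).card = 1 ∧ π.g ≤ π.horizon) :
    π.eliminate (outcome Δ η) i C Finset.univ = Finset.univ := by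
  refine π.eliminate_univ_eq_univ fun k k' => ?_
  rcases h with h | ⟨h, hgT⟩
  · rw [empMean_univ, empMean_univ, Finset.card_eq_zero.1 h]
    simpa using π.threshold_nonneg 0
  · have h1 := π.empMean_outcome_mem hb η i C k
    have h2 := π.empMean_outcome_mem hb η i C k'
    -- One arm has the default average `0`, so the observed difference can be as large as `1`
    -- whatever the gap; the threshold for a single visit still exceeds it.
    have h3 : 1 ≤ π.threshold 1 := π.le_threshold hg hgT le_rfl (by norm_num)
    rw [h]
    linarith [h1.1, h2.2]

/-- Gaps that are small compared with the number of visits are not detected. -/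
theorem active_eq_univ {Δ : I → ℝ} {h : ℝ} (h1 : h ≤ 1) (hb : ∀ x, |Δ x| ≤ h) (η : ℕ → I × I)
    (hg : 1 ≤ π.g) (C i : ℕ)
    (hV : ∀ j < i, (π.visits (outcome Δ η) (π.grid j) (π.grid (j + 1)) C).card = 0 ∨
      π.g ≤ π.horizon ∧
        (π.visits (outcome Δ η) (π.grid j) (π.grid (j + 1)) C).card * h ^ 2 ≤ 11) :
    π.active (outcome Δ η) i C = Finset.univ := by
  induction i with
  | zero => rfl
  | succ i ih =>
    change π.eliminate (outcome Δ η) i C (π.active (outcome Δ η) i C) = _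
    rw [ih fun j hj => hV j (hj.trans i.lt_succ_self)]
    have hb' : ∀ x, |Δ x| ≤ 1 := fun x => (hb x).trans h1
    by_cases hm : (π.visits (outcome Δ η) (π.grid i) (π.grid (i + 1)) C).card = 0
    · exact π.eliminate_univ_of_card_le_one hb' η hg (Or.inl hm)
    obtain ⟨hgT, hm2⟩ := (hV i i.lt_succ_self).resolve_left hm
    by_cases hm' : (π.visits (outcome Δ η) (π.grid i) (π.grid (i + 1)) C).card = 1
    · exact π.eliminate_univ_of_card_le_one hb' η hg (Or.inr ⟨hm', hgT⟩)
    refine π.eliminate_univ_eq_univ fun k k' => ?_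
    have e1 := abs_le.1 (π.abs_empMean_outcome_sub_le hb η i C k (by omega))
    have e2 := abs_le.1 (π.abs_empMean_outcome_sub_le hb η i C k' (by omega))
    have e3 := π.le_threshold hg hgT (Nat.one_le_iff_ne_zero.2 hm) hm2
    linarith [e1.1, e2.2]

/-- Flipping the sign of the gap swaps the arms. -/
theorem mem_active_neg {Δ : I → ℝ} (hb : ∀ x, |Δ x| ≤ 1) (η : ℕ → I × I) (hg : 1 ≤ π.g)
    (hgT : π.g ≤ π.horizon) (i C : ℕ) (k : Arm) :
    k ∈ π.active (outcome (fun x => -Δ x) η) i C ↔ (!k) ∈ π.active (outcome Δ η) i C := by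
  induction i generalizing k with
  | zero => simp [active]
  | succ i ih =>
    change k ∈ π.eliminate (outcome (fun x => -Δ x) η) i C
      (π.active (outcome (fun x => -Δ x) η) i C) ↔
        (!k) ∈ π.eliminate (outcome Δ η) i C (π.active (outcome Δ η) i C)
    by_cases hA : π.active (outcome Δ η) i C = Finset.univ
    · have hA' : π.active (outcome (fun x => -Δ x) η) i C = Finset.univ := by
        ext k; rw [ih, hA]; simp
      rw [hA, hA']
      -- With at most one visit the symmetry of the averages fails, but then neither run eliminates
      -- anything.
      by_cases hm : (π.visits (outcome Δ η) (π.grid i) (π.grid (i + 1)) C).card ≤ 1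
      · have hm' : (π.visits (outcome Δ η) (π.grid i) (π.grid (i + 1)) C).card = 0 ∨
            (π.visits (outcome Δ η) (π.grid i) (π.grid (i + 1)) C).card = 1 ∧
              π.g ≤ π.horizon := by omega
        rw [π.eliminate_univ_of_card_le_one hb η hg hm',
          π.eliminate_univ_of_card_le_one (Δ := fun x => -Δ x)
            (fun x => by rw [abs_neg]; exact hb x) η hg hm']
        simp
      · have hn := π.threshold_nonneg
          (π.visits (outcome Δ η) (π.grid i) (π.grid (i + 1)) C).card
        have he (k : Arm) := π.empMean_outcome_neg Δ η i C k (by omega)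
        rw [eliminate_univ, eliminate_univ]
        change k ∈ Finset.univ.filter (fun k => ¬ ∃ k', _ >
          π.threshold (π.visits (outcome Δ η) (π.grid i) (π.grid (i + 1)) C).card) ↔ _
        simp only [Finset.mem_filter, Finset.mem_univ, true_and, he, Bool.exists_bool,
          sub_sub_sub_cancel_left]
        refine not_congr ?_
        cases k <;> simp [not_lt.2 hn]
    · have hA' : π.active (outcome (fun x => -Δ x) η) i C ≠ Finset.univ := by
        intro h
        refine hA ?_
        ext k
        have := ih (!k)
        rw [h] at this
        simpa using this
      rw [π.eliminate_of_ne_univ _ _ _ hA, π.eliminate_of_ne_univ _ _ _ hA', ih]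

/-- The arm that is proposed in round `t`; it does not depend on the rewards. -/
def proposal (ω : Outcome) (t : ℕ) : Arm :=
  if t ≤ π.grid (π.M - 1) then π.roundRobin ω (π.completed t) t else π.tieArm ω t

/-- The proposal can be computed with the gap `0`, so it is common to the runs with `Δ` and `-Δ`. -/
theorem gapLoss_eq_pull (Δ : I → ℝ) (t : ℕ) (η : ℕ → I × I) : π.gapLoss Δ t η =
    (|Δ (η t).1| - armSign (pull (π.active (outcome Δ η) (π.completed t) (π.bin (η t).1))
      (π.proposal (outcome 0 η) t)) * Δ (η t).1) / 2 := rfl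

theorem gapLoss_add_neg_of_active {Δ : I → ℝ} {t : ℕ} {η : ℕ → I × I}
    (h : π.active (outcome Δ η) (π.completed t) (π.bin (η t).1) = Finset.univ)
    (h' : π.active (outcome (fun x => -Δ x) η) (π.completed t) (π.bin (η t).1) = Finset.univ) :
    π.gapLoss Δ t η + π.gapLoss (fun x => -Δ x) t η = |Δ (η t).1| := by
  rw [gapLoss_eq_pull, gapLoss_eq_pull, h, h', abs_neg]
  ring

/-- The sign of the surviving arm if exactly one arm is active, and `0` otherwise. -/
def bias (A : Finset Arm) : ℝ := if A = {true} then 1 else if A = {false} then -1 else 0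

/-- The two active sets are exchanged by `not`. Hence the proposal cancels from the sum, and only a
surviving single arm matters; this is what allows the tie rule to depend on `X_t`. -/
theorem gapLoss_add_neg {Δ : I → ℝ} (hb : ∀ x, |Δ x| ≤ 1) (hg : 1 ≤ π.g)
    (hgT : π.g ≤ π.horizon) (t : ℕ) (η : ℕ → I × I) :
    π.gapLoss Δ t η + π.gapLoss (fun x => -Δ x) t η = |Δ (η t).1| -
      bias (π.active (outcome Δ η) (π.completed t) (π.bin (η t).1)) * Δ (η t).1 := by
  have hmem := π.mem_active_neg hb η hg hgT (π.completed t) (π.bin (η t).1)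
  rw [gapLoss_eq_pull, gapLoss_eq_pull, abs_neg]
  generalize π.active (outcome Δ η) (π.completed t) (π.bin (η t).1) = A at *
  generalize π.active (outcome (fun x => -Δ x) η) (π.completed t) (π.bin (η t).1) = A' at *
  obtain rfl : A' = A.image not := by
    ext k; rw [hmem]; cases k <;> simp
  have hA : A = ∅ ∨ A = {true} ∨ A = {false} ∨ A = {true, false} := by
    clear hmem; revert A; decide
  generalize π.proposal (outcome 0 η) t = a
  rcases hA with rfl | rfl | rfl | rfl <;> cases a <;>
    simp [bias, pull, armSign, Finset.ext_iff] <;> ring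

end StaticBSE

/-! ### Undetected gaps -/

theorem volume_real_le_of_subset {s : Set I} {a b : ℝ} (hab : a ≤ b)
    (h : ∀ x ∈ s, a ≤ (x : ℝ) ∧ (x : ℝ) ≤ b) : (volume : Measure I).real s ≤ b - a := by
  have h2 : Subtype.val '' s ⊆ Set.Icc a b := by
    rintro _ ⟨x, hx, rfl⟩; exact h x hx
  rw [Measure.real, unitInterval.volume_apply]
  refine (ENNReal.toReal_mono (by simp) (measure_mono h2)).trans ?_
  rw [Real.volume_Icc, ENNReal.toReal_ofReal (by linarith)]

theorem map_context_pair {s t : ℕ} (hst : t ≠ s) :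
    baseLaw.map (fun η => ((η t).1, (η s).1)) =
      (volume : Measure I).prod (volume : Measure I) := by
  have h : baseLaw.map (fun η => (η t, η s)) =
      ((volume : Measure I).prod (volume : Measure I)).prod
        ((volume : Measure I).prod (volume : Measure I)) :=
    Measure.infinitePi_map_eval_prod hst
  have h2 := congrArg (Measure.map (Prod.map Prod.fst Prod.fst)) h
  rw [Measure.map_map (by fun_prop) (by fun_prop),
    ← Measure.map_prod_map _ _ measurable_fst measurable_fst] at h2
  rw [Measure.map_fst_prod, measure_univ, one_smul] at h2
  exact h2

theorem baseLaw_context_real {t : ℕ} {R : Set I} (hR : MeasurableSet R) :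
    baseLaw.real {η | (η t).1 ∈ R} = (volume : Measure I).real R := by
  have h : MeasurePreserving (fun η : ℕ → I × I => (η t).1) baseLaw volume :=
    measurePreserving_fst.comp (measurePreserving_eval_infinitePi _ t)
  exact h.measureReal_preimage hR.nullMeasurableSet

theorem measurable_context (t : ℕ) : Measurable fun η : ℕ → I × I => (η t).1 :=
  measurable_fst.comp (measurable_pi_apply t)

namespace StaticBSE

variable (π : StaticBSE)

theorem volume_bin_le (hg : 1 ≤ π.g) (C : ℕ) :
    (volume : Measure I).real {x | π.bin x = C} ≤ 1 / π.g := by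
  have hg' : (0 : ℝ) < π.g := by exact_mod_cast hg
  have h := volume_real_le_of_subset (s := {x | π.bin x = C}) (a := C / π.g)
    (b := (C + 1) / π.g) (by gcongr; linarith) ?_
  · refine h.trans (le_of_eq ?_)
    field_simp
    ring
  · rintro x (hx : min ⌊(π.g : ℝ) * x⌋₊ (π.g - 1) = C)
    have hx0 : 0 ≤ (π.g : ℝ) * x := mul_nonneg hg'.le x.2.1
    rw [div_le_iff₀ hg', le_div_iff₀ hg']
    constructor
    · have : C ≤ ⌊(π.g : ℝ) * x⌋₊ := hx ▸ min_le_left _ _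
      have := (Nat.le_floor_iff hx0).1 this
      linarith
    · rcases min_choice ⌊(π.g : ℝ) * x⌋₊ (π.g - 1) with h | h
      · have := Nat.lt_floor_add_one ((π.g : ℝ) * x)
        rw [← h, hx] at this
        linarith
      · have hC : (C : ℝ) + 1 = π.g := by
          rw [← hx, h]; exact_mod_cast Nat.sub_add_cancel hg
        rw [hC]
        nlinarith [x.2.2]

theorem measurableSet_sameBin {R : Set I} (hR : MeasurableSet R) (s t : ℕ) :
    MeasurableSet {η : ℕ → I × I | (η t).1 ∈ R ∧ π.bin (η s).1 = π.bin (η t).1} :=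
  (measurable_context t hR).inter (measurableSet_eq_fun
    (π.measurable_bin.comp (measurable_context s)) (π.measurable_bin.comp (measurable_context t)))

/-- By Fubini: given `X_t`, the independent uniform `X_s` falls into the same bin with probability
at most `1/g`. -/
theorem baseLaw_sameBin_le (hg : 1 ≤ π.g) {R : Set I} (hR : MeasurableSet R) {s t : ℕ}
    (hst : t ≠ s) :
    baseLaw.real {η | (η t).1 ∈ R ∧ π.bin (η s).1 = π.bin (η t).1} ≤
      (volume : Measure I).real R / π.g := by
  set E : Set (I × I) := {p | p.1 ∈ R ∧ π.bin p.2 = π.bin p.1} with hE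
  have hEm : MeasurableSet E := (measurable_fst hR).inter (measurableSet_eq_fun
    (π.measurable_bin.comp measurable_snd) (π.measurable_bin.comp measurable_fst))
  have h1 : baseLaw {η | (η t).1 ∈ R ∧ π.bin (η s).1 = π.bin (η t).1} =
      ((volume : Measure I).prod (volume : Measure I)) E := by
    rw [← map_context_pair hst, Measure.map_apply
      ((measurable_context t).prodMk (measurable_context s)) hEm]
    rfl
  have h2 : ((volume : Measure I).prod (volume : Measure I)) E ≤
      ENNReal.ofReal (1 / π.g) * volume R := by
    rw [Measure.prod_apply hEm, ← lintegral_indicator_const hR]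
    refine lintegral_mono fun x => ?_
    by_cases hx : x ∈ R
    · rw [Set.indicator_of_mem hx]
      have : Prod.mk x ⁻¹' E = {y | π.bin y = π.bin x} := by
        ext y; simp [hE, hx]
      rw [this, ← ofReal_measureReal]
      exact ENNReal.ofReal_le_ofReal (π.volume_bin_le hg _)
    · have : Prod.mk x ⁻¹' E = ∅ := by
        ext y; simp [hE, hx]
      rw [this, measure_empty]
      exact zero_le
  rw [Measure.real, h1]
  refine (ENNReal.toReal_mono (ENNReal.mul_ne_top (by simp) (measure_ne_top _ _)) h2).trans ?_
  rw [ENNReal.toReal_mul, ENNReal.toReal_ofReal (by positivity), Measure.real]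
  exact le_of_eq (by ring)

/-- If a bin with fewer than `N` visits up to round `τ` has both arms active in round `t`, and the
expected number of such visits is at most `N / 2`, then round `t` contributes to the regret. -/
theorem le_integral_gapLoss_of_visits {Δ : I → ℝ} (hm : Measurable Δ) (hb : ∀ x, |Δ x| ≤ 1)
    (hg : 1 ≤ π.g) {R : Set I} (hR : MeasurableSet R) {q N : ℝ} (hq : 0 ≤ q) (hN : 0 < N)
    (hΔ : ∀ x ∈ R, q ≤ |Δ x|) {τ t : ℕ} (hτ : τ < t) (hτN : 2 * τ ≤ N * π.g)
    (hact : ∀ η, ((π.visits (outcome Δ η) 0 τ (π.bin (η t).1)).card : ℝ) < N →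
      π.active (outcome Δ η) (π.completed t) (π.bin (η t).1) = Finset.univ ∧
      π.active (outcome (fun x => -Δ x) η) (π.completed t) (π.bin (η t).1) = Finset.univ) :
    q * (volume : Measure I).real R / 2 ≤
      ∫ η, (π.gapLoss Δ t η + π.gapLoss (fun x => -Δ x) t η) ∂baseLaw := by
  have hg' : (0 : ℝ) < π.g := by exact_mod_cast hg
  set E : ℕ → Set (ℕ → I × I) :=
    fun s => {η | (η t).1 ∈ R ∧ π.bin (η s).1 = π.bin (η t).1} with hE
  set F : Set (ℕ → I × I) := {η | (η t).1 ∈ R} with hF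
  have hEm (s : ℕ) : MeasurableSet (E s) := π.measurableSet_sameBin hR s t
  have hFm : MeasurableSet F := measurable_context t hR
  have hEi (s : ℕ) : Integrable ((E s).indicator fun _ => (1 : ℝ)) baseLaw :=
    (integrable_const 1).indicator (hEm s)
  have hFi : Integrable (F.indicator fun _ => (1 : ℝ)) baseLaw :=
    (integrable_const 1).indicator hFm
  have hSi : Integrable (fun η => ∑ s ∈ Finset.Ioc 0 τ, (E s).indicator (fun _ => (1 : ℝ)) η)
      baseLaw := integrable_finsetSum _ fun s _ => hEi s
  -- Markov's inequality in pointwise form: the bound `q * (1 - visits / N)` on `F` is at most `q`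
  -- if there are fewer than `N` visits, and nonpositive otherwise.
  have hlow : ∫ η, q * (F.indicator (fun _ => (1 : ℝ)) η -
      (∑ s ∈ Finset.Ioc 0 τ, (E s).indicator (fun _ => (1 : ℝ)) η) / N) ∂baseLaw ≤
      ∫ η, (π.gapLoss Δ t η + π.gapLoss (fun x => -Δ x) t η) ∂baseLaw := by
    refine integral_mono ((hFi.sub (hSi.div_const N)).const_mul q)
      ((π.integrable_gapLoss hm hb t).add (π.integrable_gapLoss hm.neg
        (fun x => by rw [Pi.neg_apply, abs_neg]; exact hb x) t)) fun η => ?_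
    have hnn := add_nonneg (π.gapLoss_nonneg Δ t η) (π.gapLoss_nonneg (fun x => -Δ x) t η)
    refine le_trans ?_ (le_refl (π.gapLoss Δ t η + π.gapLoss (fun x => -Δ x) t η))
    by_cases hη : (η t).1 ∈ R
    · have h1 : F.indicator (fun _ => (1 : ℝ)) η = 1 := Set.indicator_of_mem (show η ∈ F from hη) _
      have h2 : ∑ s ∈ Finset.Ioc 0 τ, (E s).indicator (fun _ => (1 : ℝ)) η =
          (π.visits (outcome Δ η) 0 τ (π.bin (η t).1)).card := by
        rw [visits, Finset.card_filter, Nat.cast_sum]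
        refine Finset.sum_congr rfl fun s _ => ?_
        change _ = ((if π.bin (η s).1 = π.bin (η t).1 then 1 else 0 : ℕ) : ℝ)
        by_cases hs : π.bin (η s).1 = π.bin (η t).1
        · rw [Set.indicator_of_mem (show η ∈ E s from ⟨hη, hs⟩), if_pos hs, Nat.cast_one]
        · rw [Set.indicator_of_notMem (fun h : η ∈ E s => hs h.2), if_neg hs, Nat.cast_zero]
      rw [h1, h2]
      by_cases hc : ((π.visits (outcome Δ η) 0 τ (π.bin (η t).1)).card : ℝ) < N
      · obtain ⟨ha, ha'⟩ := hact η hc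
        rw [π.gapLoss_add_neg_of_active ha ha']
        have : 0 ≤ ((π.visits (outcome Δ η) 0 τ (π.bin (η t).1)).card : ℝ) / N := by positivity
        nlinarith [hΔ _ hη]
      · have : 1 ≤ ((π.visits (outcome Δ η) 0 τ (π.bin (η t).1)).card : ℝ) / N := by
          rw [le_div_iff₀ hN]; linarith [not_lt.1 hc]
        nlinarith
    · have h1 : F.indicator (fun _ => (1 : ℝ)) η = 0 := Set.indicator_of_notMem (show η ∉ F from hη) _
      have h2 : 0 ≤ ∑ s ∈ Finset.Ioc 0 τ, (E s).indicator (fun _ => (1 : ℝ)) η :=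
        Finset.sum_nonneg fun s _ => Set.indicator_nonneg (fun _ _ => zero_le_one) _
      rw [h1]
      have : 0 ≤ (∑ s ∈ Finset.Ioc 0 τ, (E s).indicator (fun _ => (1 : ℝ)) η) / N := by positivity
      nlinarith
  refine le_trans ?_ hlow
  rw [integral_const_mul, integral_sub hFi (hSi.div_const N), integral_div,
    integral_finsetSum _ fun s _ => hEi s, integral_indicator_const _ hFm,
    baseLaw_context_real hR]
  have hsum : ∑ s ∈ Finset.Ioc 0 τ, ∫ η, (E s).indicator (fun _ => (1 : ℝ)) η ∂baseLaw ≤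
      τ * ((volume : Measure I).real R / π.g) := by
    refine (Finset.sum_le_card_nsmul _ _ ((volume : Measure I).real R / π.g) fun s hs => ?_).trans
      (le_of_eq ?_)
    · rw [integral_indicator_const _ (hEm s), smul_eq_mul, mul_one]
      refine π.baseLaw_sameBin_le hg hR ?_
      have := (Finset.mem_Ioc.1 hs).2
      omega
    · rw [Nat.card_Ioc, Nat.sub_zero, nsmul_eq_mul]
  have hRn : 0 ≤ (volume : Measure I).real R := measureReal_nonneg
  -- At most `τ / g ≤ N / 2` visits are expected, which leaves half of the mass of `R`.
  have hhalf : (∑ s ∈ Finset.Ioc 0 τ, ∫ η, (E s).indicator (fun _ => (1 : ℝ)) η ∂baseLaw) / N ≤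
      (volume : Measure I).real R / 2 := by
    rw [div_le_iff₀ hN]
    refine hsum.trans ?_
    rw [mul_div_assoc', div_le_iff₀ hg']
    nlinarith
  rw [smul_eq_mul, mul_one]
  nlinarith

end StaticBSE

/-! ### A gap that changes its sign within a bin -/

open Classical in
/-- The reflection of the interval `(0, c)`, extended by the identity. -/
def reflect (c x : I) : I :=
  if h : 0 < (x : ℝ) ∧ (x : ℝ) < c then ⟨c - x, by linarith [h.2], by linarith [h.1, c.2.2]⟩ else x

theorem reflect_of_mem {c x : I} (h : 0 < (x : ℝ) ∧ (x : ℝ) < c) :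
    (reflect c x : ℝ) = c - x := by
  simp only [reflect, dif_pos h]

theorem reflect_of_not_mem {c x : I} (h : ¬(0 < (x : ℝ) ∧ (x : ℝ) < c)) : reflect c x = x := by
  simp only [reflect, dif_neg h]

theorem measurableSet_openInterval (c : I) :
    MeasurableSet {x : I | 0 < (x : ℝ) ∧ (x : ℝ) < c} :=
  (measurableSet_lt measurable_const measurable_subtype_coe).inter
    (measurableSet_lt measurable_subtype_coe measurable_const)

theorem measurable_reflect (c : I) : Measurable (reflect c) := by
  classical
  refine unitInterval.measurableEmbedding_coe.measurable_comp_iff.1 ?_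
  have h : Subtype.val ∘ reflect c =
      fun x : I => if 0 < (x : ℝ) ∧ (x : ℝ) < c then (c : ℝ) - x else x := by
    funext x
    by_cases hx : 0 < (x : ℝ) ∧ (x : ℝ) < c
    · rw [Function.comp_apply, reflect_of_mem hx, if_pos hx]
    · rw [Function.comp_apply, reflect_of_not_mem hx, if_neg hx]
  rw [h]
  exact Measurable.ite (measurableSet_openInterval c) (by fun_prop) (by fun_prop)

theorem measurePreserving_reflect (c : I) :
    MeasurePreserving (reflect c) (volume : Measure I) volume := by
  refine ⟨measurable_reflect c, ?_⟩
  ext s hs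
  rw [Measure.map_apply (measurable_reflect c) hs]
  set J := {x : I | 0 < (x : ℝ) ∧ (x : ℝ) < c} with hJ
  have hJm : MeasurableSet J := measurableSet_openInterval c
  rw [← measure_inter_add_sdiff (reflect c ⁻¹' s) hJm, ← measure_inter_add_sdiff s hJm]
  congr 1
  -- On `J` the map is `y ↦ c - y`, which preserves Lebesgue measure on the line; off `J` it is the
  -- identity.
  · have himg : Subtype.val '' (reflect c ⁻¹' s ∩ J) =
        (fun y : ℝ => (c : ℝ) - y) ⁻¹' (Subtype.val '' (s ∩ J)) := by
      ext y
      constructor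
      · rintro ⟨x, ⟨hx, hxJ⟩, rfl⟩
        refine ⟨reflect c x, ⟨hx, ?_⟩, reflect_of_mem hxJ⟩
        change 0 < (reflect c x : ℝ) ∧ (reflect c x : ℝ) < c
        rw [reflect_of_mem hxJ]
        exact ⟨by linarith [hxJ.2], by linarith [hxJ.1]⟩
      · rintro ⟨x, ⟨hx, hxJ⟩, hxy⟩
        have hxy' : (x : ℝ) = c - y := hxy
        have hy : y ∈ Set.Icc (0 : ℝ) 1 :=
          ⟨by linarith [hxJ.2], by linarith [hxJ.1, c.2.2]⟩
        have hyJ : (⟨y, hy⟩ : I) ∈ J := ⟨by simp only; linarith [hxJ.2], by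
          simp only; linarith [hxJ.1]⟩
        refine ⟨⟨y, hy⟩, ⟨?_, hyJ⟩, rfl⟩
        have : reflect c ⟨y, hy⟩ = x := Subtype.ext (by rw [reflect_of_mem hyJ, hxy'])
        rw [Set.mem_preimage, this]
        exact hx
    rw [unitInterval.volume_apply, unitInterval.volume_apply, himg]
    exact (Measure.measurePreserving_sub_left volume (c : ℝ)).measure_preimage
      (unitInterval.measurableEmbedding_coe.measurableSet_image.2
        (hs.inter hJm)).nullMeasurableSet
  · congr 1
    ext x
    simp only [Set.mem_sdiff, Set.mem_preimage]
    refine and_congr_left fun hx => ?_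
    rw [reflect_of_not_mem hx]

/-- Reflect the context of round `t`. -/
def reflectAt (c : I) (t : ℕ) (η : ℕ → I × I) : ℕ → I × I :=
  fun s => (if s = t then Prod.map (reflect c) id else id) (η s)

theorem reflectAt_self (c : I) (t : ℕ) (η : ℕ → I × I) :
    reflectAt c t η t = (reflect c (η t).1, (η t).2) := by
  simp [reflectAt, Prod.map]

theorem reflectAt_of_ne (c : I) {s t : ℕ} (h : s ≠ t) (η : ℕ → I × I) :
    reflectAt c t η s = η s := by simp [reflectAt, h]

theorem measurePreserving_reflectAt (c : I) (t : ℕ) :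
    MeasurePreserving (reflectAt c t) baseLaw baseLaw := by
  have hp (s : ℕ) : MeasurePreserving (if s = t then Prod.map (reflect c) id else id)
      ((volume : Measure I).prod (volume : Measure I)) (volume.prod volume) := by
    split_ifs
    · exact (measurePreserving_reflect c).prod (MeasurePreserving.id volume)
    · exact MeasurePreserving.id _
  refine ⟨measurable_pi_lambda _ fun s => (hp s).measurable.comp (measurable_pi_apply s), ?_⟩
  refine (Measure.infinitePi_map_pi _ fun s => (hp s).measurable).trans ?_
  simp only [(hp _).map_eq]
  rfl

/-! ### Active sets under a reflection of the current context -/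

namespace StaticBSE

variable (π : StaticBSE)

theorem firstVisit_le {ω : Outcome} {i b C s : ℕ} (hs : s ∈ π.visits ω (π.grid i) b C) :
    π.firstVisit ω i s ≤ s := by
  rw [visits, Finset.mem_filter, Finset.mem_Ioc] at hs
  exact Nat.sInf_le ⟨hs.1.1, rfl⟩

theorem tieArm_congr {ω ω' : Outcome} {t : ℕ} (h : ∀ s ≤ t, ω s = ω' s) :
    π.tieArm ω t = π.tieArm ω' t := by
  unfold tieArm
  have h1 : (fun s : Finset.Icc 1 t => ctx ω s) = fun s : Finset.Icc 1 t => ctx ω' s := by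
    funext s
    simp only [ctx, h s (Finset.mem_Icc.1 s.2).2]
  rw [h1, seed, seed, h t le_rfl]

/-- A round robin consults the tie rule only at the first visit, which is no later than the visit
itself, hence within the rounds where the outcomes agree. Bins are compared at all times because
`firstVisit` is an infimum without an upper bound on the time. -/
theorem empMean_congr {ω ω' : Outcome} (hbin : ∀ s, π.bin (ctx ω s) = π.bin (ctx ω' s))
    {i : ℕ} (h : ∀ s ≤ π.grid (i + 1), ω s = ω' s) (C : ℕ) (A : Finset Arm) (k : Arm) :
    π.empMean ω i C A k = π.empMean ω' i C A k := by
  have hv (a b C : ℕ) : π.visits ω a b C = π.visits ω' a b C := by simp only [visits, hbin]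
  have hfv (t : ℕ) : π.firstVisit ω i t = π.firstVisit ω' i t := by simp only [firstVisit, hbin]
  have hS : (π.visits ω (π.grid i) (π.grid (i + 1)) C).filter
      (fun s => pull A (π.roundRobin ω i s) = k) =
      (π.visits ω' (π.grid i) (π.grid (i + 1)) C).filter
      (fun s => pull A (π.roundRobin ω' i s) = k) := by
    rw [hv]
    refine Finset.filter_congr fun s hs => ?_
    have hs2 : s ≤ π.grid (i + 1) := by
      rw [visits, Finset.mem_filter, Finset.mem_Ioc] at hs; exact hs.1.2
    have ht : π.tieArm ω (π.firstVisit ω' i s) = π.tieArm ω' (π.firstVisit ω' i s) :=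
      π.tieArm_congr fun r hr => h r ((hr.trans (π.firstVisit_le hs)).trans hs2)
    simp only [roundRobin, hv, hbin, hfv, ht]
  unfold empMean
  rw [hS]
  congr 1
  refine Finset.sum_congr rfl fun s hs => ?_
  have hs2 : s ≤ π.grid (i + 1) := by
    rw [Finset.mem_filter, visits, Finset.mem_filter, Finset.mem_Ioc] at hs; exact hs.1.1.2
  simp only [reward, h s hs2]

/-- The active sets after `i` batches are determined by the rounds up to `grid i`, if the bins of
all contexts are given. -/
theorem active_congr (hmono : Monotone π.grid) {ω ω' : Outcome}
    (hbin : ∀ s, π.bin (ctx ω s) = π.bin (ctx ω' s)) (i C : ℕ)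
    (h : ∀ s ≤ π.grid i, ω s = ω' s) : π.active ω i C = π.active ω' i C := by
  induction i with
  | zero => rfl
  | succ i ih =>
    have hv (a b C : ℕ) : π.visits ω a b C = π.visits ω' a b C := by simp only [visits, hbin]
    simp only [active, eliminate, ih fun s hs => h s (hs.trans (hmono i.le_succ)),
      π.empMean_congr hbin h, hv]

theorem bin_eq_zero {x : I} (h : (π.g : ℝ) * x < 1) : π.bin x = 0 := by
  rw [bin, Nat.floor_eq_zero.2 h, Nat.zero_min]

theorem bin_reflect (hg : 1 ≤ π.g) {c : I} (hc : (c : ℝ) = 1 / π.g) (x : I) :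
    π.bin (reflect c x) = π.bin x := by
  have hg' : (0 : ℝ) < π.g := by exact_mod_cast hg
  by_cases hx : 0 < (x : ℝ) ∧ (x : ℝ) < c
  · have hgc : (π.g : ℝ) * c = 1 := by rw [hc]; field_simp
    rw [π.bin_eq_zero, π.bin_eq_zero]
    · nlinarith [hx.2]
    · rw [reflect_of_mem hx]; nlinarith [hx.1]
  · rw [reflect_of_not_mem hx]

/-- A gap that is odd on the first bin costs regret in every round. -/
theorem le_integral_gapLoss_of_odd {Δ : I → ℝ} (hm : Measurable Δ) (hb : ∀ x, |Δ x| ≤ 1)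
    (hg : 1 ≤ π.g) (hgT : π.g ≤ π.horizon) (hmono : Monotone π.grid) {c : I}
    (hc : (c : ℝ) = 1 / π.g)
    (hodd : ∀ x : I, 0 < (x : ℝ) → (x : ℝ) < c → Δ (reflect c x) = -Δ x)
    {R : Set I} (hR : MeasurableSet R) {q : ℝ} (hq : ∀ x ∈ R, 0 < (x : ℝ) ∧ (x : ℝ) < c ∧ q ≤ |Δ x|)
    {t : ℕ} (ht : π.grid (π.completed t) < t) :
    q * (volume : Measure I).real R ≤
      ∫ η, (π.gapLoss Δ t η + π.gapLoss (fun x => -Δ x) t η) ∂baseLaw := by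
  set G : (ℕ → I × I) → ℝ := fun η => π.gapLoss Δ t η + π.gapLoss (fun x => -Δ x) t η with hG
  have hGi : Integrable G baseLaw := (π.integrable_gapLoss hm hb t).add
    (π.integrable_gapLoss hm.neg (fun x => by rw [Pi.neg_apply, abs_neg]; exact hb x) t)
  have hGn (η : ℕ → I × I) : 0 ≤ G η :=
    add_nonneg (π.gapLoss_nonneg Δ t η) (π.gapLoss_nonneg (fun x => -Δ x) t η)
  have hmp := measurePreserving_reflectAt c t
  have hGi' : Integrable (fun η => G (reflectAt c t η)) baseLaw :=
    hmp.integrable_comp_of_integrable hGi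
  have hint : ∫ η, G (reflectAt c t η) ∂baseLaw = ∫ η, G η ∂baseLaw := by
    rw [← integral_map hmp.measurable.aemeasurable, hmp.map_eq]
    rw [hmp.map_eq]
    exact hGi.aestronglyMeasurable
  set F : Set (ℕ → I × I) := {η | (η t).1 ∈ R} with hF
  have hFm : MeasurableSet F := measurable_context t hR
  -- Reflecting `X_t` keeps the active set and changes the sign of `Δ`, so the `bias` terms of the
  -- two joint losses cancel and `2 * |Δ|` remains.
  have hlow : ∫ η, F.indicator (fun _ => 2 * q) η ∂baseLaw ≤
      ∫ η, (G η + G (reflectAt c t η)) ∂baseLaw := by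
    refine integral_mono ((integrable_const _).indicator hFm) (hGi.add hGi') fun η => ?_
    by_cases hη : (η t).1 ∈ R
    · obtain ⟨hx0, hxc, hxq⟩ := hq _ hη
      have hbins (s : ℕ) : π.bin (ctx (outcome Δ (reflectAt c t η)) s) =
          π.bin (ctx (outcome Δ η) s) := by
        change π.bin (reflectAt c t η s).1 = π.bin (η s).1
        by_cases hs : s = t
        · subst hs; rw [reflectAt_self]; exact π.bin_reflect hg hc _
        · rw [reflectAt_of_ne c hs]
      have hact := π.active_congr hmono hbins (π.completed t) (π.bin (η t).1) fun s hs => by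
        simp only [outcome, reflectAt_of_ne c (show s ≠ t by omega)]
      have hbt : π.bin (reflectAt c t η t).1 = π.bin (η t).1 := hbins t
      have hΔ : Δ (reflectAt c t η t).1 = -Δ (η t).1 := by
        rw [reflectAt_self]; exact hodd _ hx0 hxc
      rw [Set.indicator_of_mem (show η ∈ F from hη)]
      simp only [hG, π.gapLoss_add_neg hb hg hgT, hbt, hact, hΔ, abs_neg]
      linarith
    · rw [Set.indicator_of_notMem (show η ∉ F from hη)]
      exact add_nonneg (hGn _) (hGn _)
  rw [integral_add hGi hGi', hint, integral_indicator_const _ hFm, baseLaw_context_real hR,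
    smul_eq_mul] at hlow
  linarith

end StaticBSE

/-! ### The two families of gap functions -/

/-- The gap that decreases from `h` to `0` with slope `l`. -/
def tent (h l : ℝ) (x : I) : ℝ := max (h - l * x) 0

theorem measurable_tent (h l : ℝ) : Measurable (tent h l) := by
  unfold tent
  exact (measurable_const.sub (measurable_subtype_coe.const_mul l)).max measurable_const

theorem abs_tent_le {h l : ℝ} (hh : 0 ≤ h) (hl : 0 ≤ l) (x : I) : |tent h l x| ≤ h := by
  unfold tent
  rw [abs_of_nonneg (le_max_right _ _)]
  exact max_le (by linarith [mul_nonneg hl x.2.1]) hh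

theorem abs_tent_sub_le {h l : ℝ} (hl : 0 ≤ l) (x x' : I) :
    |tent h l x - tent h l x'| ≤ l * |(x : ℝ) - x'| := by
  refine (abs_max_sub_max_le_abs _ _ _).trans (le_of_eq ?_)
  rw [show h - l * x - (h - l * x') = -(l * ((x : ℝ) - x')) by ring, abs_neg, abs_mul,
    abs_of_nonneg hl]

theorem volume_tent_le {h l δ : ℝ} (hl : 0 < l) (hδ : 0 ≤ δ) :
    (volume : Measure I).real {x | 0 < |tent h l x| ∧ |tent h l x| ≤ δ} ≤ δ / l := by
  refine (volume_real_le_of_subset (a := (h - δ) / l) (b := h / l) (by gcongr; linarith)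
    ?_).trans (le_of_eq (by ring))
  rintro x ⟨h1, h2⟩
  rw [tent, abs_of_nonneg (le_max_right _ _)] at h1 h2
  rw [div_le_iff₀ hl, le_div_iff₀ hl]
  have h3 := (le_max_left _ _).trans h2
  rcases lt_max_iff.1 h1 with h4 | h4
  · constructor <;> linarith
  · exact absurd h4 (lt_irrefl _)

/-- The linear gap with slope `l` and zero `a`. -/
def cross (l a : ℝ) (x : I) : ℝ := l * (x - a)

theorem measurable_cross (l a : ℝ) : Measurable (cross l a) := by
  unfold cross
  exact (measurable_subtype_coe.sub_const a).const_mul l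

theorem abs_cross_le {l a : ℝ} (hl : 0 ≤ l) (hl1 : l ≤ 1) (ha : a ∈ Set.Icc (0 : ℝ) 1) (x : I) :
    |cross l a x| ≤ 1 := by
  have hx : |(x : ℝ) - a| ≤ 1 :=
    abs_le.2 ⟨by linarith [x.2.1, ha.2], by linarith [x.2.2, ha.1]⟩
  rw [cross, abs_mul, abs_of_nonneg hl]
  nlinarith [abs_nonneg ((x : ℝ) - a)]

theorem abs_cross_sub_le {l a : ℝ} (hl : 0 ≤ l) (x x' : I) :
    |cross l a x - cross l a x'| ≤ l * |(x : ℝ) - x'| := by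
  rw [cross, cross, show l * (x - a) - l * (x' - a) = l * ((x : ℝ) - x') by ring, abs_mul,
    abs_of_nonneg hl]

theorem volume_cross_le {l a δ : ℝ} (hl : 0 < l) (hδ : 0 ≤ δ) :
    (volume : Measure I).real {x | 0 < |cross l a x| ∧ |cross l a x| ≤ δ} ≤ 2 * δ / l := by
  have hd : 0 ≤ δ / l := by positivity
  refine (volume_real_le_of_subset (a := a - δ / l) (b := a + δ / l) (by linarith)
    ?_).trans (le_of_eq (by ring))
  rintro x ⟨-, h2⟩
  rw [cross, abs_mul, abs_of_pos hl, mul_comm, ← le_div_iff₀ hl] at h2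
  have := abs_le.1 h2
  constructor <;> linarith

/-! ### Three-batch grids and the balance between grid and bins -/

theorem monotone_grid3 {t₁ t₂ T : ℕ} (h12 : t₁ < t₂) (h2T : t₂ < T) :
    Monotone (grid3 t₁ t₂ T) := by
  refine monotone_nat_of_le_succ fun n => ?_
  match n with
  | 0 => exact Nat.zero_le _
  | 1 => exact h12.le
  | 2 => exact h2T.le
  | _ + 3 => exact le_rfl

namespace StaticBSE

variable (π : StaticBSE)

theorem completed_eq {t₁ t₂ T : ℕ} (hM : π.M = 3) (hgrid : π.grid = grid3 t₁ t₂ T) (t : ℕ) :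
    π.completed t = (if t₁ < t then 1 else 0) + if t₂ < t then 1 else 0 := by
  have h : Finset.Icc 1 2 = ({1, 2} : Finset ℕ) := rfl
  rw [completed, hM, hgrid, show 3 - 1 = 2 from rfl, h, Finset.card_filter,
    Finset.sum_pair (by decide)]
  rfl

theorem grid_completed_lt {t₁ t₂ T : ℕ} (hM : π.M = 3) (hgrid : π.grid = grid3 t₁ t₂ T)
    (h12 : t₁ < t₂) {t : ℕ} (ht : 1 ≤ t) : π.grid (π.completed t) < t := by
  rw [π.completed_eq hM hgrid, hgrid]
  split_ifs with h1 h2 h2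
  · exact h2
  · exact h1
  · omega
  · exact ht

/-- The regret on instances with a small gap near `0`. -/
theorem exists_regret_ge_tent (hg : 1 ≤ π.g) (hmono : Monotone π.grid)
    {L δ₀ D₀ c₁ c₂ : ℝ} (hL : 0 < L) (hD : max (2 / L) 4 ≤ D₀) (hc₁ : c₁ ≤ 1) (hc₂ : 1 ≤ c₂)
    {S : Finset ℕ} (hS : S ⊆ Finset.Icc 1 π.horizon) {h N : ℝ} (hh : 0 < h) (hh1 : h ≤ 1 / 2)
    (hN : 0 < N) (hτ : ∀ t ∈ S, π.grid (π.completed t) < t ∧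
      2 * (π.grid (π.completed t) : ℝ) ≤ N * π.g)
    (hNh : N ≤ 1 ∨ π.g ≤ π.horizon ∧ N * h ^ 2 ≤ 11) :
    ∃ v : Instance, v.InClass 1 1 L δ₀ D₀ c₁ c₂ ∧ S.card * (h ^ 2 / 16) ≤ π.regret v := by
  -- Slope at most `2 * L` gives smoothness. Slope at most `1` keeps the tent above `h / 2` on `[0,
  -- h / 2]`; the margin constant is `1 / l`.
  set l := min (2 * L) 1 with hl
  have hl0 : 0 < l := lt_min (by linarith) one_pos
  have hl1 : l ≤ 1 := min_le_right _ _
  have hlL : l ≤ 2 * L := min_le_left _ _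
  have hb (x : I) : |tent h l x| ≤ h := abs_tent_le hh.le hl0.le x
  have hb1 (x : I) : |tent h l x| ≤ 1 := (hb x).trans (by linarith)
  have hlD : 1 / l ≤ D₀ := by
    rcases min_choice (2 * L) 1 with h' | h' <;> rw [hl, h']
    · have : 1 / (2 * L) ≤ 2 / L := by
        rw [div_le_div_iff₀ (by positivity) hL]; linarith
      exact this.trans ((le_max_left _ _).trans hD)
    · linarith [(le_max_right _ _).trans hD]
  have key := π.exists_regret_ge (measurable_tent h l) hb1 (L := L) (δ₀ := δ₀) (D₀ := D₀) hc₁ hc₂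
    (fun x x' => (abs_tent_sub_le hl0.le x x').trans (by gcongr))
    (fun δ hδ => (volume_tent_le hl0 hδ.1).trans (by
      rw [div_eq_mul_one_div, mul_comm]; exact mul_le_mul_of_nonneg_right hlD hδ.1)) hS
    -- Gap `h / 2`, on mass `h / 2`, with the factor `1 / 2` from Markov's inequality.
    (r := h ^ 2 / 8) fun t ht => ?_
  · obtain ⟨v, hv, hr⟩ := key
    exact ⟨v, hv, by linarith⟩
  · have hmem : h / 2 ∈ Set.Icc (0 : ℝ) 1 := ⟨by linarith, by linarith⟩
    have hR : (volume : Measure I).real (Set.Iic ⟨h / 2, hmem⟩) = h / 2 := by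
      rw [Measure.real, unitInterval.volume_Iic, ENNReal.toReal_ofReal hmem.1]
    have := π.le_integral_gapLoss_of_visits (measurable_tent h l) hb1 hg
      (R := Set.Iic ⟨h / 2, hmem⟩) measurableSet_Iic (q := h / 2) hmem.1 hN ?_
      (hτ t ht).1 (hτ t ht).2 ?_
    · rw [hR] at this
      linarith
    · intro x hx
      have hx' : (x : ℝ) ≤ h / 2 := hx
      refine le_trans ?_ (le_abs_self _)
      refine le_trans ?_ (le_max_left _ _)
      nlinarith [x.2.1]
    · intro η hη
      have hV : ∀ j < π.completed t,
          (π.visits (outcome (tent h l) η) (π.grid j) (π.grid (j + 1))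
            (π.bin (η t).1)).card = 0 ∨
          π.g ≤ π.horizon ∧ (π.visits (outcome (tent h l) η) (π.grid j) (π.grid (j + 1))
            (π.bin (η t).1)).card * h ^ 2 ≤ 11 := by
        intro j hj
        have hsub : π.visits (outcome (tent h l) η) (π.grid j) (π.grid (j + 1))
            (π.bin (η t).1) ⊆ π.visits (outcome (tent h l) η) 0 (π.grid (π.completed t))
              (π.bin (η t).1) :=
          Finset.filter_subset_filter _
            (Finset.Ioc_subset_Ioc (Nat.zero_le _) (hmono hj))
        have hlt : ((π.visits (outcome (tent h l) η) (π.grid j) (π.grid (j + 1))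
            (π.bin (η t).1)).card : ℝ) < N :=
          (Nat.cast_le.2 (Finset.card_le_card hsub)).trans_lt hη
        -- For `N ≤ 1`, fewer than `N` visits means none, and then no condition on `g` is needed.
        rcases hNh with h1 | ⟨h1, h2⟩
        · left
          exact Nat.lt_one_iff.1 (by exact_mod_cast hlt.trans_le h1)
        · right
          refine ⟨h1, le_trans ?_ h2⟩
          gcongr
      exact ⟨π.active_eq_univ (by linarith) hb η hg _ _ hV,
        π.active_eq_univ (Δ := fun x => -tent h l x) (by linarith)
          (fun x => by rw [abs_neg]; exact hb x) η hg _ _ hV⟩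

/-- The regret on instances whose best arm changes in the middle of the first bin. -/
theorem exists_regret_ge_cross (hg : 1 ≤ π.g) (hgT : π.g ≤ π.horizon) (hmono : Monotone π.grid)
    {L δ₀ D₀ c₁ c₂ : ℝ} (hL : 0 < L) (hD : max (2 / L) 4 ≤ D₀) (hc₁ : c₁ ≤ 1) (hc₂ : 1 ≤ c₂)
    (hτ : ∀ t, 1 ≤ t → π.grid (π.completed t) < t) :
    ∃ v : Instance, v.InClass 1 1 L δ₀ D₀ c₁ c₂ ∧
      π.horizon * (min (2 * L) 1 / (32 * (π.g : ℝ) ^ 2)) ≤ π.regret v := by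
  set l := min (2 * L) 1 with hl
  have hl0 : 0 < l := lt_min (by linarith) one_pos
  have hl1 : l ≤ 1 := min_le_right _ _
  have hlL : l ≤ 2 * L := min_le_left _ _
  have hg1 : (1 : ℝ) ≤ π.g := by exact_mod_cast hg
  have hg0 : (0 : ℝ) < π.g := by linarith
  have hinv : 1 / (π.g : ℝ) ≤ 1 := by rw [div_le_one hg0]; exact hg1
  have hinv0 : 0 < 1 / (π.g : ℝ) := by positivity
  set w := 1 / (π.g : ℝ) with hw
  have hb (x : I) : |cross l (w / 2) x| ≤ 1 :=
    abs_cross_le hl0.le hl1 ⟨by linarith, by linarith⟩ x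
  have hlD : 2 / l ≤ D₀ := by
    rcases min_choice (2 * L) 1 with h' | h' <;> rw [hl, h']
    · have : 2 / (2 * L) ≤ 2 / L := by
        rw [div_le_div_iff₀ (by positivity) hL]; linarith
      exact this.trans ((le_max_left _ _).trans hD)
    · linarith [(le_max_right _ _).trans hD]
  have key := π.exists_regret_ge (measurable_cross l (w / 2)) hb (L := L) (δ₀ := δ₀) (D₀ := D₀)
    hc₁ hc₂ (fun x x' => (abs_cross_sub_le hl0.le x x').trans (by gcongr))
    (fun δ hδ => (volume_cross_le hl0 hδ.1).trans (by
      rw [mul_div_right_comm]; exact mul_le_mul_of_nonneg_right hlD hδ.1))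
    -- On the first quarter of the bin, of mass `w / 4`, the distance to the zero `w / 2` is at
    -- least `w / 4`.
    (Finset.Subset.refl _) (r := l * w / 4 * (w / 4)) fun t ht => ?_
  · obtain ⟨v, hv, hr⟩ := key
    refine ⟨v, hv, le_trans (le_of_eq ?_) hr⟩
    rw [Nat.card_Icc, Nat.add_sub_cancel, hw]
    field_simp
    ring
  · have hmem : w / 4 ∈ Set.Icc (0 : ℝ) 1 := ⟨by linarith, by linarith⟩
    have hR : (volume : Measure I).real (Set.Ioo 0 ⟨w / 4, hmem⟩) = w / 4 := by
      rw [Measure.real, unitInterval.volume_Ioo, ENNReal.toReal_ofReal (by simpa using hmem.1)]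
      simp
    have := π.le_integral_gapLoss_of_odd (measurable_cross l (w / 2)) hb hg hgT hmono
      (c := ⟨w, hinv0.le, hinv⟩) rfl ?_ (R := Set.Ioo 0 ⟨w / 4, hmem⟩) measurableSet_Ioo
      (q := l * w / 4) ?_ (hτ t (Finset.mem_Icc.1 ht).1)
    · rwa [hR] at this
    · intro x hx0 hxc
      simp only [cross, reflect_of_mem ⟨hx0, hxc⟩]
      ring
    · rintro x ⟨hx0, hx1⟩
      have hx0' : (0 : ℝ) < x := hx0
      have hx1' : (x : ℝ) < w / 4 := hx1
      refine ⟨hx0', by simp only; linarith, ?_⟩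
      rw [cross, abs_of_nonpos (mul_nonpos_of_nonneg_of_nonpos hl0.le (by linarith))]
      nlinarith

/-- Every three-batch policy with static binning has regret of order at least `√T` on some
instance of the class. -/
theorem exists_regret_ge_sqrt {t₁ t₂ T : ℕ} (hM : π.M = 3) (hgrid : π.grid = grid3 t₁ t₂ T)
    (h1 : 1 ≤ t₁) (h12 : t₁ < t₂) (h2T : t₂ < T) (hg : 1 ≤ π.g)
    {L δ₀ D₀ c₁ c₂ : ℝ} (hL : 0 < L) (hD : max (2 / L) 4 ≤ D₀) (hc₁ : c₁ ≤ 1) (hc₂ : 1 ≤ c₂) :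
    ∃ v : Instance, v.InClass 1 1 L δ₀ D₀ c₁ c₂ ∧
      min (2 * L) 1 / 256 * √(T : ℝ) ≤ π.regret v := by
  have hmono : Monotone π.grid := hgrid ▸ monotone_grid3 h12 h2T
  have h0 : π.grid 0 = 0 := by rw [hgrid]; rfl
  have hT : π.horizon = T := by rw [horizon, hM, hgrid]; rfl
  have hcomp := π.completed_eq hM hgrid
  have hτ (t : ℕ) (ht : 1 ≤ t) := π.grid_completed_lt hM hgrid h12 ht
  have tentBound {S : Finset ℕ} (hS : S ⊆ Finset.Icc 1 T) {h N : ℝ} (hh : 0 < h)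
      (hh1 : h ≤ 1 / 2) (hN : 0 < N)
      (hS2 : ∀ t ∈ S, 2 * (π.grid (π.completed t) : ℝ) ≤ N * π.g)
      (hNh : N ≤ 1 ∨ π.g ≤ T ∧ N * h ^ 2 ≤ 11) :=
    π.exists_regret_ge_tent (δ₀ := δ₀) hg hmono hL hD hc₁ hc₂ (hT ▸ hS) hh hh1 hN
      (fun t ht => ⟨hτ t (Finset.mem_Icc.1 (hS ht)).1, hS2 t ht⟩) (hT ▸ hNh)
  set l := min (2 * L) 1
  have hl0 : 0 < l := lt_min (by linarith) one_pos
  have hl1 : l ≤ 1 := min_le_right _ _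
  have hg0 : (0 : ℝ) < π.g := by exact_mod_cast hg
  have h1' : (1 : ℝ) ≤ t₁ := by exact_mod_cast h1
  have h12' : (t₁ : ℝ) ≤ t₂ := by exact_mod_cast h12.le
  have ht2' : (0 : ℝ) < t₂ := by linarith
  have hT3 : 3 ≤ T := by omega
  have hT3' : (3 : ℝ) ≤ T := by exact_mod_cast hT3
  set u := √(√(T : ℝ))
  -- With `u = T^(1/4)` the critical scales are `u²` for `t₁`, `u` for `g`, `u³` for `t₂`, and the
  -- target is `u²`.
  have hu2 : u ^ 2 = √(T : ℝ) := Real.sq_sqrt (Real.sqrt_nonneg _)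
  have hu4 : u ^ 4 = T := by
    rw [show u ^ 4 = (u ^ 2) ^ 2 by ring, hu2, Real.sq_sqrt (Nat.cast_nonneg _)]
  have hu0 : 0 ≤ u := Real.sqrt_nonneg _
  have hu1 : 1 ≤ u := by
    by_contra hlt
    have : u ^ 4 ≤ 1 := pow_le_one₀ hu0 (not_le.1 hlt).le
    linarith
  rw [← hu2]
  suffices ∃ v : Instance, v.InClass 1 1 L δ₀ D₀ c₁ c₂ ∧
      (u ^ 2 / 256 ≤ π.regret v ∨ l * u ^ 2 / 32 ≤ π.regret v) by
    obtain ⟨v, hv, hr⟩ := this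
    refine ⟨v, hv, ?_⟩
    rcases hr with hr | hr <;> nlinarith [sq_nonneg u, mul_nonneg hl0.le (sq_nonneg u)]
  by_cases hgT : T < π.g
  -- In the first half fewer than `g / 2` rounds have passed, so the bin of `X_t` is still unvisited
  -- with probability at least `1 / 2`; a gap of constant height then costs order `T`.
  · obtain ⟨v, hv, hr⟩ := tentBound (S := Finset.Icc 1 (T / 2)) (h := 1 / 2) (N := 1)
      (Finset.Icc_subset_Icc le_rfl (by omega)) (by norm_num) le_rfl one_pos (fun t ht => by
        rw [Finset.mem_Icc] at ht
        have := hτ t ht.1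
        rw [one_mul]
        have h2 : 2 * π.grid (π.completed t) ≤ π.g := by omega
        exact_mod_cast h2) (Or.inl le_rfl)
    refine ⟨v, hv, Or.inl (le_trans ?_ hr)⟩
    have hc : T ≤ 3 * (T / 2) := by omega
    have hc' : (T : ℝ) ≤ 3 * ((T / 2 : ℕ) : ℝ) := by exact_mod_cast hc
    rw [Nat.card_Icc, Nat.add_sub_cancel]
    nlinarith [mul_nonneg (sq_nonneg u) (sub_nonneg.2 (one_le_pow₀ hu1 : 1 ≤ u ^ 2))]
  have hgT' : π.g ≤ T := not_lt.1 hgT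
  -- No batch is completed before these rounds, so a gap of constant height is paid for throughout.
  have first : ∃ v : Instance, v.InClass 1 1 L δ₀ D₀ c₁ c₂ ∧ (t₁ : ℝ) / 64 ≤ π.regret v := by
    obtain ⟨v, hv, hr⟩ := tentBound (S := Finset.Icc 1 t₁) (h := 1 / 2) (N := 1)
      (Finset.Icc_subset_Icc le_rfl (by omega)) (by norm_num) le_rfl one_pos (fun t ht => by
        rw [Finset.mem_Icc] at ht
        rw [hcomp, if_neg (by omega), if_neg (by omega), add_zero, h0]
        simp) (Or.inl le_rfl)
    refine ⟨v, hv, le_trans (le_of_eq ?_) hr⟩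
    rw [Nat.card_Icc, Nat.add_sub_cancel]
    ring
  by_cases ht1 : u ^ 2 ≤ 4 * t₁
  · obtain ⟨v, hv, hr⟩ := first
    exact ⟨v, hv, Or.inl (by linarith)⟩
  push Not at ht1
  have hu2' : 2 ≤ u := by nlinarith
  by_cases hgu : (π.g : ℝ) ≤ u
  · obtain ⟨v, hv, hr⟩ := π.exists_regret_ge_cross (δ₀ := δ₀) hg (hT ▸ hgT') hmono hL hD hc₁ hc₂ hτ
    refine ⟨v, hv, Or.inr (le_trans ?_ hr)⟩
    rw [hT, ← hu4, mul_div_assoc', div_le_div_iff₀ (by norm_num) (by positivity)]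
    have : (π.g : ℝ) ^ 2 ≤ u ^ 2 := by gcongr
    nlinarith [mul_nonneg hl0.le (sq_nonneg u), mul_le_mul_of_nonneg_left this
      (mul_nonneg hl0.le (sq_nonneg u))]
  push Not at hgu
  by_cases ht2 : u ^ 3 ≤ t₂
  -- Long second batch: with `t₁ < u² / 4` and `g > u`, `N = 2 * t₁ / g` is below `u / 2`, so height
  -- `1 / (2 * √u)` is undetected and costs order `1 / u` in each of about `u³` rounds.
  · have hsq : (1 / (2 * √u)) ^ 2 = 1 / (4 * u) := by
      rw [div_pow, mul_pow, Real.sq_sqrt hu0]; norm_num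
    have hsu : 1 ≤ √u := Real.one_le_sqrt.2 hu1
    obtain ⟨v, hv, hr⟩ := tentBound (S := Finset.Ioc t₁ t₂) (h := 1 / (2 * √u))
      (N := 2 * t₁ / π.g) (fun t ht => by
        rw [Finset.mem_Ioc] at ht; exact Finset.mem_Icc.2 (by omega)) (by positivity)
      (by gcongr; linarith) (by positivity) (fun t ht => by
        rw [Finset.mem_Ioc] at ht
        rw [hcomp, if_pos ht.1, if_neg (by omega), hgrid]
        change 2 * (t₁ : ℝ) ≤ _
        rw [div_mul_cancel₀ _ hg0.ne']) (Or.inr ⟨hgT', by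
        rw [hsq, div_mul_div_comm, div_le_iff₀ (by positivity)]
        nlinarith⟩)
    refine ⟨v, hv, Or.inl (le_trans ?_ hr)⟩
    rw [hsq, Nat.card_Ioc, Nat.cast_sub h12.le, div_div, mul_one_div,
      le_div_iff₀ (by positivity)]
    nlinarith [mul_nonneg (sq_nonneg u) (sub_nonneg.2 hu2')]
  -- Short second batch: now `N = 2 * t₂ / g` is below `2 * u²`, so height `1 / (2 * u)` survives to
  -- the last batch, whose length is at least `u⁴ - u³ ≥ u⁴ / 2`.
  · push Not at ht2
    obtain ⟨v, hv, hr⟩ := tentBound (S := Finset.Ioc t₂ T) (h := 1 / (2 * u))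
      (N := 2 * t₂ / π.g) (fun t ht => by
        rw [Finset.mem_Ioc] at ht; exact Finset.mem_Icc.2 (by omega)) (by positivity)
      (by gcongr; linarith) (by positivity) (fun t ht => by
        rw [Finset.mem_Ioc] at ht
        rw [hcomp, if_pos (by omega), if_pos ht.1, hgrid]
        change 2 * (t₂ : ℝ) ≤ _
        rw [div_mul_cancel₀ _ hg0.ne']) (Or.inr ⟨hgT', by
        rw [div_pow, div_mul_div_comm, div_le_iff₀ (by positivity)]
        nlinarith [mul_le_mul_of_nonneg_right hgu.le (sq_nonneg u)]⟩)
    refine ⟨v, hv, Or.inl (le_trans ?_ hr)⟩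
    rw [div_pow, Nat.card_Ioc, Nat.cast_sub h2T.le, div_div, mul_div_assoc',
      le_div_iff₀ (by positivity), ← hu4]
    nlinarith [mul_nonneg (pow_nonneg hu0 3) (sub_nonneg.2 hu2')]

end StaticBSE

end BatchedBandit

end

theorem theorem4 :
    ∃ κ : ℝ, 0 < κ ∧
      ∀ L : ℝ, 0 < L →
        ∃ C₁ : ℝ, 0 < C₁ ∧
          ∀ δ₀ D₀ c₁ c₂ : ℝ, 0 < δ₀ → δ₀ < 1 → max (2 / L) 4 ≤ D₀ →
            0 < c₁ → c₁ ≤ 1 → 1 ≤ c₂ →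
          ∀ π : BatchedBandit.StaticBSE, ∀ t₁ t₂ T : ℕ,
            π.M = 3 → π.grid = BatchedBandit.grid3 t₁ t₂ T →
            1 ≤ t₁ → t₁ < t₂ → t₂ < T → 1 ≤ π.g →
            ∃ v : BatchedBandit.Instance,
              v.InClass 1 1 L δ₀ D₀ c₁ c₂ ∧
                C₁ * (T : ℝ) ^ ((9 : ℝ) / 19 + κ) ≤ π.regret v := by
  refine ⟨1 / 38, by norm_num, fun L hL => ⟨min (2 * L) 1 / 256, ?_, ?_⟩⟩
  · have : 0 < min (2 * L) 1 := lt_min (by linarith) one_pos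
    positivity
  · intro δ₀ D₀ c₁ c₂ _ _ hD _ hc₁ hc₂ π t₁ t₂ T hM hgrid h1 h12 h2T hg
    rw [show (9 : ℝ) / 19 + 1 / 38 = 1 / 2 by norm_num, ← Real.sqrt_eq_rpow]
    exact π.exists_regret_ge_sqrt hM hgrid h1 h12 h2T hg hL hD hc₁ hc₂
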